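/- Let $L_1$ be the space of real integrable functions on $[0,1]$ with Lebesgue measure $\mu$, let $\mathfrak X$ be a real Banach space with dual $\mathfrak X^*$, and let $S(\mathfrak X^*)$ be the unit sphere of $\mathfrak X^*$. A bounded linear operator is completely continuous if it carries weakly convergent sequences to norm convergent sequences. A dyadic splitting of a set $A^0_1$ of positive measure is a system of measurable sets $\{A^n_k : n\ge 0,\ 1\le k\le 2^n\}$ such that each $A^n_k$ is partitioned into $A^{n+1}_{2k-1}$ and $A^{n+1}_{2k}$, which have equal measure. Its Haar system $\{h_j\}_{j\ge1}$ is $$h_1=\frac{1}{\mu(A^0_1)}1_{A^0_1},\qquad h_{2^n+k}=\frac{2^n}{\mu(A^0_1)}\bigl(1_{A^{n+1}_{2k-1}}-1_{A^{n+1}_{2k}}\bigr)\quad(n\ge0,\ 1\le k\le 2^n).$$ A set $N\subset S(\mathfrak X^*)$ norms a subspace $\mathfrak X_0$ of $\mathfrak X$ within $\tau>1$ if for each $x\in\mathfrak X_0$ there is $x^*\in N$ with $\|x\|\le\tau x^*(x)$. A sequence $\{\mathfrak X_n\}_{n\ge0}$ of finite dimensional subspaces of $\mathfrak X$ forms a finite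 dimensional decomposition with constant at most $K$ if each $x$ in the closed linear span of $\bigcup_n\mathfrak X_n$ has a unique norm convergent expansion $x=\sum_{n\ge0} x_n$ with $x_n\in\mathfrak X_n$, and $\|\sum_{n<N}x_n\|\le K\|x\|$ for all such $x$ and all $N$. **Theorem 1.** Let $T: L_1\to\mathfrak X$ be a bounded linear operator that is not completely continuous, and let $\{\tau_n\}_{n\ge0}$ be a sequence of real numbers larger than $1$. Then there exist a dyadic splitting $\{A^n_k\}$ of a set of positive measure, a sequence $\{x^*_{t_n}\}_{n\ge0}$ in $S(\mathfrak X^*)$, and for each $n\ge0$ a finite set $\{y^*_{n,i}\}_{i=1}^{p_n}$ in $S(\mathfrak X^*)$, such that for the corresponding Haar system $\{h_j\}$, some $\delta>0$, and every $n\ge0$: 1. $x^*_{t_n}(Th_{2^n+k})>\delta$ for $k=1,\dots,2^n$; 2. $\{y^*_{n,i}\}_{i=1}^{p_n}$ norms $\mathrm{sp}(Th_j : 1\le j\le 2^n)$ within $\tau_n$; 3. $y^*_{n,i}(Th_{2^n+k})=0$ for $k=1,\dots,2^n$ and $i=1,\dots,p_n$. Moreover, if $\prod_n\tau_n$ is finite,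 then for every dyadic splitting of a set of positive measure and all finite sets $\{y^*_{n,i}\}_{i=1}^{p_n}\subset S(\mathfrak X^*)$, $n\ge0$, that satisfy (2) and (3) for every $n\ge0$, the blocks $\{\mathrm{sp}(Th_j : 2^{n-1}<j\le 2^n)\}_{n\ge0}$ form a finite dimensional decomposition (of their closed linear span) with constant at most $\prod_n\tau_n$. -/

import Mathlib

open MeasureTheory Filter Topology

/-- The space `L₁ = L₁([0,1])` of real integrable functions for Lebesgue measure on `[0,1]`. -/
noncomputable abbrev L1 : Type := Lp ℝ 1 (volume : Measure unitInterval)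

/-- A bounded operator is completely continuous if it carries weakly convergent sequences to
norm convergent sequences. -/
def IsCompletelyContinuous {E F : Type*} [NormedAddCommGroup E] [NormedSpace ℝ E]
    [NormedAddCommGroup F] [NormedSpace ℝ F] (T : E →L[ℝ] F) : Prop :=
  ∀ (f : ℕ → E) (g : E),
    Tendsto (fun m => toWeakSpace ℝ E (f m)) atTop (𝓝 (toWeakSpace ℝ E g)) →
      ∃ y : F, Tendsto (fun m => T (f m)) atTop (𝓝 y)

/-- A dyadic splitting `{A n k : n ≥ 0, 1 ≤ k ≤ 2 ^ n}` of a set `A 0 1` of positive measure.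
`NullMeasurableSet` is Lebesgue (not only Borel) measurability. The values `A n k` at other indices
`k` play no role. -/
structure DyadicSplitting where
  /-- the sets of the splitting -/
  A : ℕ → ℕ → Set unitInterval
  nullMeasurable : ∀ n k, 1 ≤ k → k ≤ 2 ^ n → NullMeasurableSet (A n k) volume
  pos : 0 < volume (A 0 1)
  union_eq : ∀ n k, 1 ≤ k → k ≤ 2 ^ n → A (n + 1) (2 * k - 1) ∪ A (n + 1) (2 * k) = A n k
  disjoint : ∀ n k, 1 ≤ k → k ≤ 2 ^ n → Disjoint (A (n + 1) (2 * k - 1)) (A (n + 1) (2 * k))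
  measure_eq : ∀ n k, 1 ≤ k → k ≤ 2 ^ n →
    volume (A (n + 1) (2 * k - 1)) = volume (A (n + 1) (2 * k))

namespace DyadicSplitting

/-- The function `(2 ^ n / μ(A 0 1)) (1_{A (n+1) (2k-1)} - 1_{A (n+1) (2k)})`. -/
noncomputable def haarLevel (S : DyadicSplitting) (n k : ℕ) : unitInterval → ℝ := fun ω =>
  2 ^ n / volume.real (S.A 0 1) *
    ((S.A (n + 1) (2 * k - 1)).indicator (fun _ => (1 : ℝ)) ω
      - (S.A (n + 1) (2 * k)).indicator (fun _ => (1 : ℝ)) ω)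

/-- The normalized Haar functions `h j`, `j ≥ 1`, of a dyadic splitting:
`h 1 = 1_{A 0 1} / μ(A 0 1)`, and `h (2 ^ n + k) = haarLevel n k` for `1 ≤ k ≤ 2 ^ n`
(see `haarFun_one` and `haarFun_two_pow_add`). The value at the unused index `0` is `0`. -/
noncomputable def haarFun (S : DyadicSplitting) (j : ℕ) : unitInterval → ℝ :=
  if j = 0 then 0
  else if j = 1 then
    fun ω => 1 / volume.real (S.A 0 1) * (S.A 0 1).indicator (fun _ => (1 : ℝ)) ω
  else S.haarLevel (Nat.log 2 (j - 1)) (j - 2 ^ Nat.log 2 (j - 1))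

theorem haarFun_one (S : DyadicSplitting) : S.haarFun 1 =
    fun ω => 1 / volume.real (S.A 0 1) * (S.A 0 1).indicator (fun _ => (1 : ℝ)) ω := by
  simp [haarFun]

theorem haarFun_two_pow_add (S : DyadicSplitting) (n k : ℕ) (hk : 1 ≤ k) (hk' : k ≤ 2 ^ n) :
    S.haarFun (2 ^ n + k) = S.haarLevel n k := by
  have h1 : 1 ≤ 2 ^ n := Nat.one_le_two_pow
  have hlog : Nat.log 2 (2 ^ n + k - 1) = n :=
    (Nat.log_eq_iff (Or.inr ⟨by omega, by omega⟩)).2 ⟨by omega, by rw [pow_succ]; omega⟩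
  rw [haarFun, if_neg (by omega), if_neg (by omega), hlog, Nat.add_sub_cancel_left]

theorem memLp_indicator {B : Set unitInterval} (hB : NullMeasurableSet B volume) :
    MemLp (B.indicator fun _ => (1 : ℝ)) 1 (volume : Measure unitInterval) := by
  refine MemLp.of_bound (aestronglyMeasurable_const.indicator₀ hB) 1 (Eventually.of_forall ?_)
  intro ω
  by_cases h : ω ∈ B <;> simp [h]

theorem memLp_haarFun (S : DyadicSplitting) (j : ℕ) :
    MemLp (S.haarFun j) 1 (volume : Measure unitInterval) := by
  rcases Nat.lt_or_ge j 2 with hj | hj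
  · interval_cases j
    · simp [haarFun]
    · rw [haarFun_one]
      exact (memLp_indicator (S.nullMeasurable 0 1 le_rfl (by simp))).const_mul _
  · rw [haarFun, if_neg (by omega), if_neg (by omega)]
    have h1 : 2 ^ Nat.log 2 (j - 1) ≤ j - 1 := Nat.pow_log_le_self 2 (by omega)
    have h2 : j - 1 < 2 ^ (Nat.log 2 (j - 1) + 1) := Nat.lt_pow_succ_log_self (by omega) _
    generalize Nat.log 2 (j - 1) = n at h1 h2 ⊢
    rw [pow_succ] at h2
    refine ((memLp_indicator (S.nullMeasurable _ _ ?_ ?_)).sub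
      (memLp_indicator (S.nullMeasurable _ _ ?_ ?_))).const_mul _
    all_goals (try rw [pow_succ]); omega

/-- The Haar system of a dyadic splitting, as elements of `L₁`. -/
noncomputable def haar (S : DyadicSplitting) (j : ℕ) : L1 :=
  (S.memLp_haarFun j).toLp (S.haarFun j)

end DyadicSplitting

/-- A set `N` in the unit sphere of the dual of `X` norms the subspace `V` within `τ`. -/
def NormsWithin {X : Type*} [NormedAddCommGroup X] [NormedSpace ℝ X]
    (N : Set (StrongDual ℝ X)) (V : Submodule ℝ X) (τ : ℝ) : Prop :=
  (∀ f ∈ N, ‖f‖ = 1) ∧ ∀ x ∈ V, ∃ f ∈ N, ‖x‖ ≤ τ * f x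

/-- The sequence `V` of subspaces of `X` forms a finite dimensional decomposition (of its closed
linear span) with constant at most `K`: each `V n` is finite dimensional, each `x` in the closed
span has a unique expansion `x = ∑ v n` with `v n ∈ V n`, and the partial sum projections
`∑ v n ↦ ∑_{n < N} v n` all have norm at most `K`. -/
structure IsFDDWithConstantLE {X : Type*} [NormedAddCommGroup X] [NormedSpace ℝ X]
    (V : ℕ → Submodule ℝ X) (K : ℝ) : Prop where
  finiteDimensional : ∀ n, FiniteDimensional ℝ (V n)
  existsUnique_expansion : ∀ x ∈ (⨆ n, V n).topologicalClosure, ∃! v : ℕ → X,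
    (∀ n, v n ∈ V n) ∧ Tendsto (fun N => ∑ n ∈ Finset.range N, v n) atTop (𝓝 x)
  norm_partialSum_le : ∀ (x : X) (v : ℕ → X), (∀ n, v n ∈ V n) →
    Tendsto (fun N => ∑ n ∈ Finset.range N, v n) atTop (𝓝 x) →
      ∀ N, ‖∑ n ∈ Finset.range N, v n‖ ≤ K * ‖x‖

/-- `sp (T h_j : 1 ≤ j ≤ 2 ^ n)`. -/
noncomputable def initialSpan {X : Type*} [NormedAddCommGroup X] [NormedSpace ℝ X]
    (T : L1 →L[ℝ] X) (S : DyadicSplitting) (n : ℕ) : Submodule ℝ X :=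
  Submodule.span ℝ {x | ∃ j : ℕ, 1 ≤ j ∧ j ≤ 2 ^ n ∧ x = T (S.haar j)}

/-- The `n`-th block `sp (T h_j : 2 ^ (n - 1) < j ≤ 2 ^ n)`, `n ≥ 0`; the first inequality is
multiplied by `2`, so that the block `n = 0` consists of `j = 1`. -/
noncomputable def haarBlock {X : Type*} [NormedAddCommGroup X] [NormedSpace ℝ X]
    (T : L1 →L[ℝ] X) (S : DyadicSplitting) (n : ℕ) : Submodule ℝ X :=
  Submodule.span ℝ {x | ∃ j : ℕ, 2 ^ n < 2 * j ∧ j ≤ 2 ^ n ∧ x = T (S.haar j)}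

/-!
Suppose that `T` is not completely continuous. Weakly null `w n` with `‖T (w n)‖` bounded below and
norming functionals `x n` of the vectors `T (w n)` give bounded functions `g n`, the densities of
`x n ∘ T`, with weak-* limit `g'` along an ultrafilter. Because weakly null sequences in `L₁` are
uniformly integrable (`exists_setIntegral_abs_le_of_weaklyNull`), `g n` does not converge to `g'` in
`L₁`-norm. The weak-* limit of `|g n - g'|` is therefore bounded below on a set `B` of positive
measure, so that the oscillation of `g n` persists on *every* subset `A` of `B`, in proportion to
`μ(A)` (`exists_oscillating_functionals`).

Oscillation on finitely many sets `A` of one level is turned into a splitting of all of them.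
The signs of `g n - g'`, minus their weak-* limit, are functionals that see the oscillation and tend
to `0` on any finite family of functions, in particular on `1_A` and on `1_A · (y ∘ T)` for the
finitely many `y` that norm the span built so far. A small correction makes them vanish exactly
(`exists_linear_correction`), and Lyapunov's theorem (`exists_set_of_functional`, by Krein-Milman)
replaces them by differences of indicator functions. The values on `1_A` being `0` means that
each `A` is halved; the values on `1_A · (y ∘ T)` being `0` means that `y` kills the new Haar
functions. Iterating gives the dyadic splitting (`exists_dyadicSplitting`).

For the decomposition, a functional `y` that norms the first blocks within `τ n` and kills the next
one shows that adding a block shrinks the norm at most by the factor `τ n`, and the partial sums of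
any expansion are bounded by the product (`isFDDWithConstantLE_haarBlock`).
-/

/-! ### Bounded functionals on `L₁` and their densities -/

section Functionals
variable {Ω : Type*} [MeasurableSpace Ω] {μ : Measure Ω}

theorem integrable_bdd_mul_L1 {g : Ω → ℝ} (hg : Measurable g) {M : ℝ} (hM : ∀ x, |g x| ≤ M)
    (v : Lp ℝ 1 μ) : Integrable (fun x => g x * v x) μ :=
  (L1.integrable_coeFn v).bdd_mul hg.aestronglyMeasurable (Eventually.of_forall hM)

/-- A bounded function acts on `L₁` by integration, with norm at most its bound. -/
theorem exists_functional_of_bounded {g : Ω → ℝ} (hg : Measurable g) {M : ℝ} (h0 : 0 ≤ M)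
    (hM : ∀ x, |g x| ≤ M) :
    ∃ F : StrongDual ℝ (Lp ℝ 1 μ), ‖F‖ ≤ M ∧ ∀ v, F v = ∫ x, g x * v x ∂μ := by
  refine ⟨LinearMap.mkContinuous
    { toFun := fun v => ∫ x, g x * v x ∂μ
      map_add' := fun v w => ?_
      map_smul' := fun c v => ?_ } M fun v => ?_,
    LinearMap.mkContinuous_norm_le _ h0 _, fun v => rfl⟩
  · rw [← integral_add (integrable_bdd_mul_L1 hg hM v) (integrable_bdd_mul_L1 hg hM w)]
    refine integral_congr_ae ?_
    filter_upwards [Lp.coeFn_add v w] with x hx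
    show g x * (v + w : Lp ℝ 1 μ) x = _
    rw [hx, Pi.add_apply, mul_add]
  · rw [RingHom.id_apply, smul_eq_mul, ← integral_const_mul]
    refine integral_congr_ae ?_
    filter_upwards [Lp.coeFn_smul c v] with x hx
    show g x * (c • v : Lp ℝ 1 μ) x = _
    rw [hx, Pi.smul_apply, smul_eq_mul]; ring
  · rw [L1.norm_eq_integral_norm, ← integral_const_mul]
    refine (norm_integral_le_integral_norm _).trans
      (integral_mono (integrable_bdd_mul_L1 hg hM v).norm
        ((L1.integrable_coeFn v).norm.const_mul M) fun x => ?_)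
    simp only [norm_mul]
    exact mul_le_mul_of_nonneg_right (hM x) (norm_nonneg _)

/-- Every functional on `L₁` of a finite measure is integration against a function, measurable and
bounded everywhere by the norm. The Riesz theorem in `L₂` gives the function; testing on indicator
functions bounds it, and indicator functions determine the functional. -/
theorem exists_density [IsFiniteMeasure μ] (F : StrongDual ℝ (Lp ℝ 1 μ)) :
    ∃ g : Ω → ℝ, Measurable g ∧ (∀ x, |g x| ≤ ‖F‖) ∧ ∀ v, F v = ∫ x, g x * v x ∂μ := by
  let J : Lp ℝ 2 μ →L[ℝ] Lp ℝ 1 μ :=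
    (ContinuousLinearMap.mul ℝ ℝ).holderL μ 2 2 1 (Lp.const 2 μ (1 : ℝ))
  have hJ : ∀ v : Lp ℝ 2 μ, J v =ᵐ[μ] v := fun v => by
    have h := (ContinuousLinearMap.mul ℝ ℝ).coeFn_holder (r := 1) (Lp.const 2 μ (1 : ℝ)) v
    have h' := Lp.coeFn_const (p := 2) (μ := μ) (1 : ℝ)
    filter_upwards [h, h'] with x hx hx'
    refine hx.trans ?_
    rw [hx']; simp
  let u : Lp ℝ 2 μ := (InnerProductSpace.toDual ℝ (Lp ℝ 2 μ)).symm (F.comp J)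
  have hu : ∀ v : Lp ℝ 2 μ, F (J v) = ∫ x, u x * v x ∂μ := fun v => by
    have h : inner ℝ u v = F (J v) := InnerProductSpace.toDual_symm_apply
    rw [← h, L2.inner_def]
    simp [mul_comm]
  have hui : Integrable u μ := (Lp.memLp u).integrable (by norm_num)
  have hset : ∀ s (hs : MeasurableSet s),
      F (indicatorConstLp 1 hs (measure_ne_top μ s) (1 : ℝ)) = ∫ x in s, u x ∂μ := by
    intro s hs
    have e : J (indicatorConstLp 2 hs (measure_ne_top μ s) (1 : ℝ))
        = indicatorConstLp 1 hs (measure_ne_top μ s) (1 : ℝ) := by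
      refine Lp.ext ((hJ _).trans ?_)
      exact indicatorConstLp_coeFn.trans indicatorConstLp_coeFn.symm
    rw [← e, hu, ← integral_indicator hs]
    refine integral_congr_ae ?_
    filter_upwards [indicatorConstLp_coeFn (p := 2) (hs := hs) (hμs := measure_ne_top μ s)
      (c := (1 : ℝ))] with x hx
    rw [hx]
    by_cases h : x ∈ s <;> simp [h]
  have hbd : ∀ s (hs : MeasurableSet s), |∫ x in s, u x ∂μ| ≤ ‖F‖ * μ.real s := by
    intro s hs
    rw [← hset s hs]
    refine (F.le_opNorm _).trans ?_
    rw [norm_indicatorConstLp one_ne_zero ENNReal.one_ne_top]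
    simp
  have hle : ∀ᵐ x ∂μ, u x ≤ ‖F‖ :=
    ae_le_of_forall_setIntegral_le hui (integrable_const _) fun s hs _ => by
      simpa [mul_comm] using (le_abs_self _).trans (hbd s hs)
  have hge : ∀ᵐ x ∂μ, -‖F‖ ≤ u x :=
    ae_le_of_forall_setIntegral_le (integrable_const _) hui fun s hs _ => by
      have := (neg_le_abs _).trans (hbd s hs)
      simp only [integral_const, measureReal_restrict_apply_univ, smul_eq_mul]
      linarith [mul_comm ‖F‖ (μ.real s)]
  obtain ⟨g, hg, hgb, hgu⟩ : ∃ g : Ω → ℝ, Measurable g ∧ (∀ x, |g x| ≤ ‖F‖) ∧ u =ᵐ[μ] g := by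
    refine ⟨fun x => max (-‖F‖) (min ‖F‖ (u x)), ?_, fun x => ?_, ?_⟩
    · exact measurable_const.max (measurable_const.min (Lp.stronglyMeasurable u).measurable)
    · have := norm_nonneg F
      rw [abs_le]
      exact ⟨le_max_left _ _, max_le (by linarith) (min_le_left _ _)⟩
    · filter_upwards [hle, hge] with x h1 h2
      rw [min_eq_right h1, max_eq_right h2]
  obtain ⟨G, -, hG⟩ := exists_functional_of_bounded (μ := μ) hg (norm_nonneg F) hgb
  refine ⟨g, hg, hgb, fun v => ?_⟩
  rw [← hG]
  refine Lp.induction ENNReal.one_ne_top (motive := fun v => F v = G v) ?_ ?_ ?_ v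
  · intro c s hs hμs
    have e : (Lp.simpleFunc.indicatorConst 1 hs hμs.ne c : Lp ℝ 1 μ)
        = c • indicatorConstLp 1 hs (measure_ne_top μ s) (1 : ℝ) := by
      rw [Lp.simpleFunc.coe_indicatorConst]
      refine Lp.ext ?_
      filter_upwards [indicatorConstLp_coeFn (p := 1) (hs := hs) (hμs := hμs.ne) (c := c),
        indicatorConstLp_coeFn (p := 1) (hs := hs) (hμs := hμs.ne) (c := (1 : ℝ)),
        Lp.coeFn_smul c (indicatorConstLp 1 hs hμs.ne (1 : ℝ))] with x h1 h2 h3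
      rw [h1, h3, Pi.smul_apply, h2]
      by_cases h : x ∈ s <;> simp [h]
    rw [e, map_smul, map_smul, hset s hs, hG, ← integral_indicator hs]
    congr 1
    refine integral_congr_ae ?_
    filter_upwards [indicatorConstLp_coeFn (p := 1) (hs := hs) (hμs := measure_ne_top μ s)
      (c := (1 : ℝ)), hgu] with x hx hx'
    rw [hx]
    by_cases h : x ∈ s <;> simp [h, hx']
  · intro f g hf hg _ h1 h2
    rw [map_add, map_add, h1, h2]
  · exact isClosed_eq F.continuous G.continuous

/-- Banach-Alaoglu for densities: a uniformly bounded sequence of functions has a weak-* limit along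
any ultrafilter. -/
theorem exists_weakStar_limit [IsFiniteMeasure μ] (U : Ultrafilter ℕ) {g : ℕ → Ω → ℝ}
    (hg : ∀ n, Measurable (g n)) {M : ℝ} (h0 : 0 ≤ M) (hM : ∀ n x, |g n x| ≤ M) :
    ∃ g' : Ω → ℝ, Measurable g' ∧ (∀ x, |g' x| ≤ M) ∧ ∀ v : Lp ℝ 1 μ,
      Tendsto (fun n => ∫ x, g n x * v x ∂μ) U (𝓝 (∫ x, g' x * v x ∂μ)) := by
  choose F hFn hF using fun n => exists_functional_of_bounded (μ := μ) (hg n) h0 (hM n)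
  have hc := WeakDual.isCompact_closedBall (𝕜 := ℝ) (0 : StrongDual ℝ (Lp ℝ 1 μ)) M
  obtain ⟨F', hF'm, hF'⟩ := hc.ultrafilter_le_nhds
    (U.map fun n => StrongDual.toWeakDual (F n)) (by
      rw [Ultrafilter.coe_map, le_principal_iff, mem_map]
      exact Eventually.of_forall fun n => by simpa using hFn n)
  have hn : ‖WeakDual.toStrongDual F'‖ ≤ M := by simpa using hF'm
  obtain ⟨g', hg', hgb, hgi⟩ := exists_density (μ := μ) (WeakDual.toStrongDual F')
  refine ⟨g', hg', fun x => (hgb x).trans hn, fun v => ?_⟩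
  rw [← hgi v]
  have h := ((WeakDual.eval_continuous v).tendsto F').comp
    (show Tendsto _ (U : Filter ℕ) _ from hF')
  refine h.congr fun n => ?_
  exact hF n v

end Functionals

/-! ### A Lyapunov theorem: functionals agree with signs on finitely many functions -/

section Lyapunov

theorem integrable_polynomial_mul (p : Polynomial ℝ) (v : L1) :
    Integrable (fun x : unitInterval => p.eval (x : ℝ) * v x) volume := by
  have hc : Continuous fun x : unitInterval => p.eval (x : ℝ) :=
    p.continuous.comp continuous_subtype_val
  obtain ⟨K, hK⟩ := isCompact_univ.exists_bound_of_continuousOn hc.continuousOn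
  exact integrable_bdd_mul_L1 hc.measurable (fun x => hK x trivial) v

/-- A nonzero polynomial orthogonal on `D` to finitely many integrable functions, found by counting
dimensions. -/
theorem exists_polynomial_setIntegral_eq_zero {ι : Type*} [Fintype ι] (v : ι → L1)
    (D : Set unitInterval) :
    ∃ p : Polynomial ℝ, p ≠ 0 ∧ ∀ i, ∫ x in D, p.eval (x : ℝ) * v i x = 0 := by
  let Λ : Polynomial.degreeLT ℝ (Fintype.card ι + 1) →ₗ[ℝ] (ι → ℝ) :=
    LinearMap.pi fun i =>
      { toFun := fun p => ∫ x in D, p.1.eval (x : ℝ) * v i x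
        map_add' := fun p q => by
          rw [← integral_add (integrable_polynomial_mul p.1 (v i)).integrableOn
            (integrable_polynomial_mul q.1 (v i)).integrableOn]
          simp [add_mul]
        map_smul' := fun c p => by
          rw [RingHom.id_apply, smul_eq_mul, ← integral_const_mul]
          simp [mul_assoc] }
  have hker : LinearMap.ker Λ ≠ ⊥ := by
    have : FiniteDimensional ℝ (Polynomial.degreeLT ℝ (Fintype.card ι + 1)) :=
      Module.Finite.equiv (Polynomial.degreeLTEquiv ℝ (Fintype.card ι + 1)).symm
    refine LinearMap.ker_ne_bot_of_finrank_lt ?_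
    rw [(Polynomial.degreeLTEquiv ℝ (Fintype.card ι + 1)).finrank_eq]
    simp
  obtain ⟨p, hp, hp0⟩ := Submodule.exists_mem_ne_zero_of_ne_bot hker
  refine ⟨p.1, fun h => hp0 (Subtype.ext h), fun i => ?_⟩
  exact congrFun (LinearMap.mem_ker.1 hp) i

/-- An extreme point of a section of the dual unit ball of `L₁` by finitely many equations has a
density of absolute value `1`. If `|g| ≤ 1 - η` on a set `D` of positive measure, `g` could be moved
in both directions `±ψ` with `ψ` a small multiple of a polynomial on `D` orthogonal to the given
functions; `ψ` is not null because a polynomial has finitely many zeros. -/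
theorem ae_abs_eq_one_of_extreme {ι : Type*} [Fintype ι] {v : ι → L1} {c : ι → ℝ}
    {F : WeakDual ℝ L1}
    (hF : F ∈ Set.extremePoints ℝ {G : WeakDual ℝ L1 |
      ‖WeakDual.toStrongDual G‖ ≤ 1 ∧ ∀ i, G (v i) = c i})
    {g : unitInterval → ℝ} (hg : Measurable g) (hg1 : ∀ x, |g x| ≤ 1)
    (hFg : ∀ w : L1, F w = ∫ x, g x * w x) : ∀ᵐ x : unitInterval, |g x| = 1 := by
  have key : ∀ m : ℕ, volume {x | |g x| ≤ 1 - 1 / ((m : ℝ) + 1)} = 0 := by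
    intro m
    set η : ℝ := 1 / ((m : ℝ) + 1) with hη
    have hη0 : 0 < η := by positivity
    set D := {x | |g x| ≤ 1 - η} with hD
    have hDm : MeasurableSet D := measurableSet_le hg.abs measurable_const
    obtain ⟨p, hp0, hp⟩ := exists_polynomial_setIntegral_eq_zero v D
    have hc : Continuous fun x : unitInterval => p.eval (x : ℝ) :=
      p.continuous.comp continuous_subtype_val
    obtain ⟨K, hK⟩ := isCompact_univ.exists_bound_of_continuousOn hc.continuousOn
    have hK' : ∀ x : unitInterval, |p.eval (x : ℝ)| ≤ |K| + 1 := fun x =>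
      (hK x trivial).trans ((le_abs_self K).trans (by linarith))
    have hK0 : 0 < |K| + 1 := by positivity
    set ψ : unitInterval → ℝ := D.indicator fun x => η / (|K| + 1) * p.eval (x : ℝ) with hψ
    have hψm : Measurable ψ := (hc.measurable.const_mul _).indicator hDm
    have hψD : ∀ x, |ψ x| ≤ 1 - |g x| := by
      intro x
      by_cases hx : x ∈ D
      · rw [hψ, Set.indicator_of_mem hx, abs_mul, abs_of_pos (by positivity : 0 < η / (|K| + 1))]
        have h1 : η / (|K| + 1) * |p.eval (x : ℝ)| ≤ η / (|K| + 1) * (|K| + 1) := by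
          gcongr; exact hK' x
        rw [div_mul_cancel₀ _ hK0.ne'] at h1
        have h2 : |g x| ≤ 1 - η := hx
        linarith
      · rw [hψ, Set.indicator_of_notMem hx]
        simpa using hg1 x
    have hψ1 : ∀ x, |ψ x| ≤ 1 := fun x => (hψD x).trans (by linarith [abs_nonneg (g x)])
    have hψv : ∀ i, ∫ x, ψ x * v i x = 0 := by
      intro i
      have e : (fun x => ψ x * v i x)
          = D.indicator fun x => η / (|K| + 1) * (p.eval (x : ℝ) * v i x) := by
        funext x
        by_cases hx : x ∈ D <;> simp [hψ, hx, mul_assoc]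
      rw [e, integral_indicator hDm, integral_const_mul, hp i, mul_zero]
    -- the functionals with densities `g + ψ` and `g - ψ` lie in the convex set, with midpoint `F`
    have hmem : ∀ σ : ℝ, |σ| = 1 → ∃ G : WeakDual ℝ L1,
        (‖WeakDual.toStrongDual G‖ ≤ 1 ∧ ∀ i, G (v i) = c i) ∧
          ∀ w : L1, G w = F w + σ * ∫ x, ψ x * w x := by
      intro σ hσ
      obtain ⟨G, hGn, hG⟩ := exists_functional_of_bounded (μ := (volume : Measure unitInterval))
        (hg.add (hψm.const_mul σ)) zero_le_one (fun x => by
          have h1 := abs_add_le (g x) (σ * ψ x)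
          rw [abs_mul, hσ, one_mul] at h1
          exact h1.trans (by linarith [hψD x]))
      have hGw : ∀ w : L1, G w = F w + σ * ∫ x, ψ x * w x := by
        intro w
        rw [hG, hFg, ← integral_const_mul, ← integral_add (integrable_bdd_mul_L1 hg hg1 w)
          ((integrable_bdd_mul_L1 hψm hψ1 w).const_mul σ)]
        simp [add_mul, mul_assoc]
      refine ⟨StrongDual.toWeakDual G, ⟨by simpa using hGn, fun i => ?_⟩, hGw⟩
      rw [← hF.1.2 i]
      refine (hGw (v i)).trans ?_
      rw [hψv, mul_zero, add_zero]
    obtain ⟨G₁, hG₁, hG₁w⟩ := hmem 1 (by simp)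
    obtain ⟨G₂, hG₂, hG₂w⟩ := hmem (-1) (by simp)
    have heq : G₁ = F := by
      refine (mem_extremePoints.1 hF).2 G₁ hG₁ G₂ hG₂
        ⟨1 / 2, 1 / 2, by norm_num, by norm_num, by norm_num, ?_⟩ |>.1
      refine DFunLike.ext _ _ fun w => ?_
      change (1 / 2 : ℝ) * G₁ w + (1 / 2 : ℝ) * G₂ w = F w
      rw [hG₁w, hG₂w]; ring
    have hψi : Integrable ψ (volume : Measure unitInterval) :=
      (integrable_const (1 : ℝ)).mono' hψm.aestronglyMeasurable (Eventually.of_forall hψ1)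
    have h0 : ∫ x, ψ x * ψ x = 0 := by
      have h1 := hG₁w (hψi.toL1 ψ)
      rw [heq] at h1
      have h2 : ∫ x, ψ x * (hψi.toL1 ψ) x = ∫ x, ψ x * ψ x := by
        refine integral_congr_ae ?_
        filter_upwards [hψi.coeFn_toL1] with x hx
        rw [hx]
      rw [← h2]; linarith
    have h3 : (fun x => ψ x * ψ x) =ᵐ[volume] 0 :=
      (integral_eq_zero_iff_of_nonneg (fun x => mul_self_nonneg _)
        (hψi.bdd_mul hψm.aestronglyMeasurable (Eventually.of_forall hψ1))).1 h0
    have hfin : volume {x : unitInterval | p.eval (x : ℝ) = 0} = 0 := by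
      refine Set.Finite.measure_zero ?_ _
      refine Set.Finite.preimage (f := ((↑) : unitInterval → ℝ)) Subtype.val_injective.injOn
        (s := {y | p.eval y = 0}) ?_
      exact (p.roots.toFinset.finite_toSet).subset fun y hy => by
        simpa [hp0] using hy
    have h4 : ∀ᵐ x : unitInterval, x ∉ D := by
      filter_upwards [h3, compl_mem_ae_iff.2 hfin] with x hx hx' hxD
      have : ψ x = 0 := by simpa using hx
      rw [hψ, Set.indicator_of_mem hxD] at this
      rcases mul_eq_zero.1 this with h | h
      · exact absurd h (by positivity)
      · exact hx' h
    rw [ae_iff] at h4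
    simpa using h4
  rw [ae_iff]
  refine measure_mono_null (fun x hx => ?_) (measure_iUnion_null key)
  have hx' : 0 < 1 - |g x| := sub_pos.2 (lt_of_le_of_ne (hg1 x) hx)
  obtain ⟨m, hm⟩ := exists_nat_one_div_lt hx'
  exact Set.mem_iUnion.2 ⟨m, by simp only [Set.mem_ofPred_eq]; linarith⟩

/-- Lyapunov's theorem in the form used below: on finitely many functions, a functional of norm at
most `1` agrees with integration against `1_E - 1_{Eᶜ}` for some measurable `E`. The set `E` comes
from an extreme point of the weak-* compact set of all functionals of norm at most `1` with the
prescribed values. -/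
theorem exists_set_of_functional {ι : Type*} [Fintype ι] (v : ι → L1) (F₀ : StrongDual ℝ L1)
    (hF₀ : ‖F₀‖ ≤ 1) :
    ∃ E : Set unitInterval, MeasurableSet E ∧
      ∀ i, (∫ x in E, v i x) - (∫ x in Eᶜ, v i x) = F₀ (v i) := by
  let C : Set (WeakDual ℝ L1) :=
    {G | ‖WeakDual.toStrongDual G‖ ≤ 1 ∧ ∀ i, G (v i) = F₀ (v i)}
  have hC : IsCompact C := by
    have h1 := WeakDual.isCompact_closedBall (𝕜 := ℝ) (0 : StrongDual ℝ L1) 1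
    have h2 : IsClosed {G : WeakDual ℝ L1 | ∀ i, G (v i) = F₀ (v i)} := by
      simp only [Set.ofPred_forall]
      exact isClosed_iInter fun i => isClosed_eq (WeakDual.eval_continuous _) continuous_const
    convert h1.inter_right h2 using 1
    ext G
    simp [C]
  have : LocallyConvexSpace ℝ (WeakDual ℝ L1) :=
    (WeakDual.withSeminorms (𝕜 := ℝ) (E := L1)).toLocallyConvexSpace
  obtain ⟨F, hF⟩ := hC.extremePoints_nonempty
    ⟨StrongDual.toWeakDual F₀, by simpa using hF₀, fun i => rfl⟩
  obtain ⟨g, hg, hgb, hFg⟩ := exists_density (WeakDual.toStrongDual F)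
  have hg1 : ∀ x, |g x| ≤ 1 := fun x => (hgb x).trans hF.1.1
  have hae := ae_abs_eq_one_of_extreme hF hg hg1 hFg
  have hE : MeasurableSet {x | 0 < g x} := measurableSet_lt measurable_const hg
  refine ⟨{x | 0 < g x}, hE, fun i => ?_⟩
  rw [← hF.1.2 i]
  refine Eq.trans ?_ (hFg (v i)).symm
  have hi := L1.integrable_coeFn (v i)
  rw [← integral_indicator hE, ← integral_indicator hE.compl,
    ← integral_sub (hi.indicator hE) (hi.indicator hE.compl)]
  refine integral_congr_ae ?_
  filter_upwards [hae] with x hx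
  by_cases h : 0 < g x
  · have : g x = 1 := by rwa [abs_of_pos h] at hx
    simp [this]
  · have : g x = -1 := by
      rw [abs_of_nonpos (not_lt.1 h)] at hx
      linarith
    simp [this]

end Lyapunov

/-! ### Uniform integrability of weakly null sequences -/

section UniformIntegrability

theorem exists_measurable_sign : ∃ s : ℝ → ℝ, Measurable s ∧ (∀ t, |s t| ≤ 1) ∧
    ∀ t, s t * t = |t| := by
  refine ⟨fun t => if 0 ≤ t then 1 else -1,
    Measurable.ite measurableSet_Ici measurable_const measurable_const, fun t => ?_, fun t => ?_⟩
  · dsimp only; split_ifs <;> simp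
  · dsimp only; split_ifs with h
    · rw [one_mul, abs_of_nonneg h]
    · rw [abs_of_neg (not_le.1 h)]; ring

variable {Ω : Type*} [MeasurableSpace Ω] {μ : Measure Ω}

/-- Modifying a bounded function on sets of measure tending to `0` does
not change its weak-* limit. -/
theorem tendsto_integral_of_eq_off_small {g₀ : Ω → ℝ} (hg₀ : Measurable g₀)
    (hg₀1 : ∀ x, |g₀ x| ≤ 1) {a : ℕ → Ω → ℝ} (ha : ∀ j, Measurable (a j))
    (ha1 : ∀ j x, |a j x| ≤ 1) {E : ℕ → Set Ω} (hEm : ∀ j, MeasurableSet (E j))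
    (hE : Tendsto (fun j => μ (E j)) atTop (𝓝 0)) (haE : ∀ j, ∀ x ∉ E j, a j x = g₀ x)
    (v : Lp ℝ 1 μ) :
    Tendsto (fun j => ∫ x, a j x * v x ∂μ) atTop (𝓝 (∫ x, g₀ x * v x ∂μ)) := by
  have hv := L1.integrable_coeFn v
  have h1 : Tendsto (fun j => 2 * ∫ x in E j, |v x| ∂μ) atTop (𝓝 0) := by
    simpa using (hv.abs.tendsto_setIntegral_nhds_zero hE).const_mul 2
  rw [tendsto_iff_norm_sub_tendsto_zero]
  refine squeeze_zero (fun j => norm_nonneg _) (fun j => ?_) h1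
  rw [← integral_sub (integrable_bdd_mul_L1 (ha j) (ha1 j) v) (integrable_bdd_mul_L1 hg₀ hg₀1 v),
    ← integral_const_mul, ← integral_indicator (hEm j)]
  refine (norm_integral_le_integral_norm _).trans (integral_mono
    ((integrable_bdd_mul_L1 (ha j) (ha1 j) v).sub (integrable_bdd_mul_L1 hg₀ hg₀1 v)).norm
    ((hv.abs.const_mul 2).indicator (hEm j)) fun x => ?_)
  by_cases hx : x ∈ E j
  · rw [Set.indicator_of_mem hx]
    simp only [← sub_mul, norm_mul, Real.norm_eq_abs]
    gcongr
    exact (abs_sub _ _).trans (by linarith [ha1 j x, hg₀1 x])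
  · simp [hx, haE j x hx]

/-- A weakly null sequence in `L₁` is uniformly integrable. The weak-* compact dual ball is a Baire
space, so for some `N` the functionals that are at most `ε / 2` on all `w m`, `m ≥ N`,
contain a relative weak-* neighbourhood of some `φ₀`. Replacing the density of `φ₀` on a
set of small measure by the sign of `w m`, or by `0`, stays in that neighbourhood,
and the two replacements differ by the integral of `|w m|` over the small set. -/
theorem exists_setIntegral_abs_le_of_weaklyNull [IsFiniteMeasure μ] {w : ℕ → Lp ℝ 1 μ}
    (hw : ∀ F : StrongDual ℝ (Lp ℝ 1 μ), Tendsto (fun m => F (w m)) atTop (𝓝 0))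
    {ε : ℝ} (hε : 0 < ε) :
    ∃ r : ℝ, 0 < r ∧ ∃ N, ∀ m ≥ N, ∀ E, MeasurableSet E → μ.real E ≤ r →
      ∫ x in E, |w m x| ∂μ ≤ ε := by
  have hK := WeakDual.isCompact_closedBall (𝕜 := ℝ) (0 : StrongDual ℝ (Lp ℝ 1 μ)) 1
  set K : Set (WeakDual ℝ (Lp ℝ 1 μ)) :=
    WeakDual.toStrongDual ⁻¹' Metric.closedBall (0 : StrongDual ℝ (Lp ℝ 1 μ)) 1 with hKdef
  have : CompactSpace K := isCompact_iff_compactSpace.1 hK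
  have : Nonempty K := ⟨⟨0, by simp [hKdef]⟩⟩
  let Q : ℕ → Set K := fun N => {φ | ∀ m ≥ N, |φ.1 (w m)| ≤ ε / 2}
  have hQc : ∀ N, IsClosed (Q N) := fun N => by
    simp only [Q, Set.ofPred_forall]
    exact isClosed_iInter fun m => isClosed_iInter fun _ => isClosed_le
      ((WeakDual.eval_continuous (w m)).comp continuous_subtype_val).abs continuous_const
  have hQu : ⋃ N, Q N = Set.univ := by
    refine Set.eq_univ_of_forall fun φ => ?_
    have h := (hw (WeakDual.toStrongDual φ.1)).abs.eventually_le_const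
      (show |(0 : ℝ)| < ε / 2 by simpa using hε)
    obtain ⟨N, hN⟩ := eventually_atTop.1 h
    exact Set.mem_iUnion.2 ⟨N, hN⟩
  obtain ⟨N, φ₀, hφ₀⟩ := nonempty_interior_of_iUnion_of_closed hQc hQu
  obtain ⟨g₀, hg₀, hg₀b, hg₀i⟩ := exists_density (μ := μ) (WeakDual.toStrongDual φ₀.1)
  have hg₀1 : ∀ x, |g₀ x| ≤ 1 := fun x => (hg₀b x).trans (by
    have h : φ₀.1 ∈ K := φ₀.2
    simpa only [hKdef, Set.mem_preimage, mem_closedBall_zero_iff] using h)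
  by_contra hcon
  push Not at hcon
  have hcon' : ∀ j : ℕ, ∃ m ≥ N, ∃ E, MeasurableSet E ∧ μ.real E ≤ 1 / ((j : ℝ) + 1) ∧
      ε < ∫ x in E, |w m x| ∂μ := fun j => hcon _ (by positivity) N
  choose m hm E hEm hEr hEw using hcon'
  have hE0 : Tendsto (fun j => μ (E j)) atTop (𝓝 0) := by
    have h1 : Tendsto (fun j => μ.real (E j)) atTop (𝓝 0) :=
      squeeze_zero (fun j => measureReal_nonneg) hEr tendsto_one_div_add_atTop_nhds_zero_nat
    simpa using ENNReal.tendsto_ofReal h1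
  obtain ⟨s, hs, hs1, hsm⟩ := exists_measurable_sign
  -- any modification of `g₀` on the small sets `E j` ends up in the interior of `Q N`
  have hmod : ∀ a : ℕ → Ω → ℝ, (∀ j, Measurable (a j)) → (∀ j x, |a j x| ≤ 1) →
      (∀ j, ∀ x ∉ E j, a j x = g₀ x) →
      ∀ᶠ j in atTop, |∫ x, a j x * w (m j) x ∂μ| ≤ ε / 2 := by
    intro a ha ha1 haE
    choose A hAn hA using fun j => exists_functional_of_bounded (μ := μ) (ha j) zero_le_one (ha1 j)
    let A' : ℕ → K := fun j => ⟨StrongDual.toWeakDual (A j), by simpa [hKdef] using hAn j⟩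
    have hlim : Tendsto A' atTop (𝓝 φ₀) := by
      rw [tendsto_subtype_rng]
      refine tendsto_iff_forall_eval_tendsto_topDualPairing.2 fun v => ?_
      have h := tendsto_integral_of_eq_off_small hg₀ hg₀1 ha ha1 hEm hE0 haE v
      rw [← hg₀i v] at h
      exact h.congr fun j => (hA j v).symm
    filter_upwards [hlim (mem_interior_iff_mem_nhds.1 hφ₀)] with j hj
    rw [← hA j]
    exact hj (m j) (hm j)
  have hS : ∀ j, Measurable fun x => s (w (m j) x) := fun j =>
    hs.comp (Lp.stronglyMeasurable (w (m j))).measurable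
  classical
  have h1 := hmod (fun j => (E j).piecewise (fun x => s (w (m j) x)) g₀)
    (fun j => (hS j).piecewise (hEm j) hg₀)
    (fun j x => by by_cases h : x ∈ E j <;> simp [h, hs1, hg₀1])
    (fun j x hx => by simp [hx])
  have h2 := hmod (fun j => (E j).piecewise (fun _ => 0) g₀)
    (fun j => measurable_const.piecewise (hEm j) hg₀)
    (fun j x => by by_cases h : x ∈ E j <;> simp [h, hg₀1])
    (fun j x hx => by simp [hx])
  obtain ⟨j, hj1, hj2⟩ := (h1.and h2).exists
  have hdiff : ∫ x in E j, |w (m j) x| ∂μ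
      = ∫ x, (E j).piecewise (fun x => s (w (m j) x)) g₀ x * w (m j) x ∂μ
        - ∫ x, (E j).piecewise (fun _ => 0) g₀ x * w (m j) x ∂μ := by
    rw [← integral_sub, ← integral_indicator (hEm j)]
    · refine integral_congr_ae (Eventually.of_forall fun x => ?_)
      by_cases h : x ∈ E j <;> simp [h, hsm]
    · exact integrable_bdd_mul_L1 ((hS j).piecewise (hEm j) hg₀) (M := 1)
        (fun x => by by_cases h : x ∈ E j <;> simp [h, hs1, hg₀1]) _
    · exact integrable_bdd_mul_L1 (measurable_const.piecewise (hEm j) hg₀) (M := 1)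
        (fun x => by by_cases h : x ∈ E j <;> simp [h, hg₀1]) _
  have := hEw j
  rw [hdiff] at this
  linarith [(abs_le.1 hj1).2, (abs_le.1 hj2).1]

end UniformIntegrability

/-! ### Weakly null sequences -/

section WeaklyNull
variable {E F : Type*} [NormedAddCommGroup E] [NormedSpace ℝ E]
  [NormedAddCommGroup F] [NormedSpace ℝ F]

theorem exists_weaklyNull_of_not_isCompletelyContinuous {T : E →L[ℝ] F}
    (hT : ¬ IsCompletelyContinuous T) :
    ∃ w : ℕ → E, (∀ φ : StrongDual ℝ E, Tendsto (fun m => φ (w m)) atTop (𝓝 0)) ∧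
      ∃ ε : ℝ, 0 < ε ∧ ∃ᶠ m in atTop, ε ≤ ‖T (w m)‖ := by
  unfold IsCompletelyContinuous at hT
  push Not at hT
  obtain ⟨f, g, hfg, hnot⟩ := hT
  refine ⟨fun m => f m - g, fun φ => ?_, ?_⟩
  · have h := ((WeakBilin.eval_continuous (topDualPairing ℝ E).flip φ).tendsto _).comp hfg
    have h' : Tendsto (fun m => φ (f m)) atTop (𝓝 (φ g)) := h
    simpa using h'.sub_const (φ g)
  · have h := hnot (T g)
    rw [Metric.tendsto_atTop] at h
    push Not at h
    obtain ⟨ε, hε, h⟩ := h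
    refine ⟨ε, hε, frequently_atTop.2 fun a => ?_⟩
    obtain ⟨n, hn, hd⟩ := h a
    exact ⟨n, hn, by rwa [map_sub, ← dist_eq_norm]⟩

theorem exists_norm_le_of_weaklyNull {w : ℕ → E}
    (hw : ∀ φ : StrongDual ℝ E, Tendsto (fun m => φ (w m)) atTop (𝓝 0)) :
    ∃ C : ℝ, ∀ m, ‖w m‖ ≤ C := by
  obtain ⟨C, hC⟩ := banach_steinhaus (g := fun m => NormedSpace.inclusionInDoubleDual ℝ E (w m))
    fun φ => by
      obtain ⟨C, hC⟩ := (Metric.isBounded_range_of_tendsto _ (hw φ)).exists_norm_le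
      exact ⟨C, fun m => hC _ ⟨m, rfl⟩⟩
  refine ⟨C, fun m => ?_⟩
  exact ((NormedSpace.inclusionInDoubleDualLi ℝ (E := E)).norm_map (w m)).ge.trans (hC m)

end WeaklyNull

/-! ### Functionals that oscillate on every subset of a fixed set -/

section Oscillation
variable {Ω : Type*} [MeasurableSpace Ω] {μ : Measure Ω}

/-- Bounded functions `g m` with integrals against a weakly null sequence bounded away from `0` stay
away from every bounded `g'` in `L₁`-norm: by uniform integrability the part of the integral where
`w m` is large is negligible. -/
theorem exists_le_integral_abs_sub [IsFiniteMeasure μ] {w : ℕ → Lp ℝ 1 μ}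
    (hw : ∀ φ : StrongDual ℝ (Lp ℝ 1 μ), Tendsto (fun m => φ (w m)) atTop (𝓝 0))
    {M : ℝ} {g : ℕ → Ω → ℝ} (hg : ∀ n, Measurable (g n)) (hgM : ∀ n x, |g n x| ≤ M)
    {g' : Ω → ℝ} (hg' : Measurable g') (hgM' : ∀ x, |g' x| ≤ M)
    {ε : ℝ} (hε : 0 < ε) {l : Filter ℕ} (hl : l ≤ atTop)
    (hgw : ∀ᶠ m in l, ε ≤ ∫ x, g m x * w m x ∂μ) :
    ∃ ε' : ℝ, 0 < ε' ∧ ∀ᶠ m in l, ε' ≤ ∫ x, |g m x - g' x| ∂μ := by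
  obtain ⟨C, hC⟩ := exists_norm_le_of_weaklyNull hw
  have hC0 : 0 ≤ C := (norm_nonneg _).trans (hC 0)
  obtain ⟨G, -, hG⟩ := exists_functional_of_bounded (μ := μ) hg' (abs_nonneg M)
    (fun x => (hgM' x).trans (le_abs_self M))
  have hM0 : 0 < |M| + 1 := by positivity
  obtain ⟨r, hr, N, hN⟩ := exists_setIntegral_abs_le_of_weaklyNull hw
    (ε := ε / (8 * (|M| + 1))) (by positivity)
  -- by Markov's inequality, `|w m| ≥ R` holds on a set of measure at most `C / R ≤ r`
  set R : ℝ := (C + 1) / r with hR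
  have hR0 : 0 < R := by positivity
  refine ⟨ε / (4 * R), by positivity, ?_⟩
  have h1 : ∀ᶠ m in l, G (w m) < ε / 2 :=
    hl ((hw G).eventually_lt_const (by positivity))
  filter_upwards [hgw, h1, hl (eventually_ge_atTop N)] with m hm1 hm2 hm3
  rw [hG] at hm2
  set E : Set Ω := {x | R ≤ |w m x|} with hE
  have hwm : Measurable (w m) := (Lp.stronglyMeasurable (w m)).measurable
  have hwi : Integrable (w m) μ := L1.integrable_coeFn (w m)
  have hEm : MeasurableSet E := measurableSet_le measurable_const hwm.abs
  have hEr : μ.real E ≤ r := by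
    have h2 := mul_meas_ge_le_integral_of_nonneg (μ := μ) (f := fun x => |w m x|)
      (Eventually.of_forall fun x => abs_nonneg _) hwi.abs R
    have h3 : ∫ x, |w m x| ∂μ = ‖w m‖ := by
      simp only [L1.norm_eq_integral_norm, Real.norm_eq_abs]
    rw [h3] at h2
    have h4 : R * μ.real E ≤ R * r := by
      rw [hR, div_mul_cancel₀ _ hr.ne']
      exact h2.trans ((hC m).trans (by linarith))
    exact le_of_mul_le_mul_left h4 hR0
  have h5 := hN m hm3 E hEm hEr
  have hb : ∀ x, |g m x - g' x| ≤ 2 * |M| := fun x => by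
    have := (abs_sub (g m x) (g' x))
    linarith [hgM m x, hgM' x, le_abs_self M]
  have hui : Integrable (fun x => |g m x - g' x|) μ :=
    (integrable_const (2 * |M|)).mono' ((hg m).sub hg').abs.aestronglyMeasurable
      (Eventually.of_forall fun x => by simpa using hb x)
  have h6 : ∫ x, g m x * w m x ∂μ - ∫ x, g' x * w m x ∂μ
      ≤ 2 * |M| * ∫ x in E, |w m x| ∂μ + R * ∫ x, |g m x - g' x| ∂μ := by
    have hi1 := integrable_bdd_mul_L1 (hg m) (hgM m) (w m)
    have hi2 := integrable_bdd_mul_L1 hg' hgM' (w m)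
    rw [← integral_sub hi1 hi2, ← integral_indicator hEm, ← integral_const_mul,
      ← integral_const_mul, ← integral_add ((hwi.abs.indicator hEm).const_mul _)
        (hui.const_mul _)]
    refine integral_mono (hi1.sub hi2) (((hwi.abs.indicator hEm).const_mul _).add
      (hui.const_mul _)) fun x => ?_
    dsimp only
    rw [← sub_mul]
    refine (le_abs_self _).trans ?_
    rw [abs_mul]
    have h7 := abs_nonneg (g m x - g' x)
    by_cases hx : x ∈ E
    · rw [Set.indicator_of_mem hx]
      have := mul_le_mul_of_nonneg_right (hb x) (abs_nonneg (w m x))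
      have := mul_nonneg hR0.le h7
      linarith
    · rw [Set.indicator_of_notMem hx, mul_zero, zero_add, mul_comm]
      exact mul_le_mul_of_nonneg_right (not_le.1 hx).le h7
  have h8 : 2 * |M| * ∫ x in E, |w m x| ∂μ ≤ ε / 4 := by
    have h9 : 2 * |M| * ∫ x in E, |w m x| ∂μ
        ≤ 2 * (|M| + 1) * (ε / (8 * (|M| + 1))) :=
      mul_le_mul (by linarith) h5 (integral_nonneg fun x => abs_nonneg _) (by positivity)
    refine h9.trans (le_of_eq ?_)
    field_simp
    norm_num
  rw [div_le_iff₀ (by positivity)]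
  linarith

theorem integral_mul_eq_setIntegral {A : Set Ω} (hA : MeasurableSet A) {g h : Ω → ℝ} {v : Lp ℝ 1 μ}
    (hv : v =ᵐ[μ] A.indicator g) : ∫ x, h x * v x ∂μ = ∫ x in A, h x * g x ∂μ := by
  rw [← integral_indicator hA]
  refine integral_congr_ae ?_
  filter_upwards [hv] with x hx
  rw [hx]
  by_cases h : x ∈ A <;> simp [h]

theorem exists_L1_indicator [IsFiniteMeasure μ] {A : Set Ω} (hA : MeasurableSet A) {g : Ω → ℝ}
    (hg : Measurable g) {M : ℝ} (hM : ∀ x, |g x| ≤ M) :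
    ∃ v : Lp ℝ 1 μ, v =ᵐ[μ] A.indicator g :=
  have h : Integrable (A.indicator g) μ := ((integrable_const M).mono' hg.aestronglyMeasurable
    (Eventually.of_forall hM)).indicator hA
  ⟨h.toL1 _, h.coeFn_toL1⟩

/-- If `T` is not completely continuous, there are norm one functionals `x n`, with `x n ∘ T` given
by `g n`, and a set `B` such that on every `A ⊆ B` of positive measure the functions `g n` are
detected, to an amount proportional to `μ(A)`, by weak-* null functionals `Φ n` of norm at most `1`.

If `g'` is the weak-* limit of `g n`, then `|g n - g'|` does not tend to `0` in `L₁`, so its weak-*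
limit `a` has positive integral, and `B` is a set where `a` is bounded below. The functional `Φ n`
is integration against half the difference of the sign of `g n - g'` and the weak-* limit `s'` of
these signs; its limit on `1_A g n` is half the integral of `a` over `A`. -/
theorem exists_oscillating_functionals [IsProbabilityMeasure μ] {X : Type*}
    [NormedAddCommGroup X] [NormedSpace ℝ X] {T : Lp ℝ 1 μ →L[ℝ] X}
    (hT : ¬ IsCompletelyContinuous T) :
    ∃ (B : Set Ω) (c M : ℝ) (U : Ultrafilter ℕ) (x : ℕ → StrongDual ℝ X) (g : ℕ → Ω → ℝ)
      (Φ : ℕ → StrongDual ℝ (Lp ℝ 1 μ)),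
      MeasurableSet B ∧ 0 < μ B ∧ 0 < c ∧ (∀ n, ‖x n‖ = 1) ∧
      (∀ n, Measurable (g n)) ∧ (∀ n t, |g n t| ≤ M) ∧
      (∀ n v, x n (T v) = ∫ t, g n t * v t ∂μ) ∧
      (∀ n, ‖Φ n‖ ≤ 1) ∧ (∀ v, Tendsto (fun n => Φ n v) U (𝓝 0)) ∧
      ∀ A ⊆ B, MeasurableSet A → 0 < μ A → ∀ v : ℕ → Lp ℝ 1 μ,
        (∀ n, v n =ᵐ[μ] A.indicator (g n)) →
          ∃ L, c * μ.real A < L ∧ Tendsto (fun n => Φ n (v n)) U (𝓝 L) := by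
  obtain ⟨w, hw, ε, hε, hfreq⟩ := exists_weaklyNull_of_not_isCompletelyContinuous hT
  have : Nontrivial X := by
    obtain ⟨m, hm⟩ := hfreq.exists
    exact ⟨⟨T (w m), 0, fun h => by rw [h, norm_zero] at hm; linarith⟩⟩
  choose x hx1 hxw using fun m => exists_dual_vector' ℝ (T (w m))
  choose g hg hgF hxg using fun n => exists_density (μ := μ) ((x n).comp T)
  have hgM : ∀ n t, |g n t| ≤ ‖T‖ := fun n t =>
    (hgF n t).trans (((x n).opNorm_comp_le T).trans (by rw [hx1, one_mul]))
  have : NeBot (atTop ⊓ 𝓟 {m | ε ≤ ‖T (w m)‖}) := frequently_mem_iff_neBot.1 hfreq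
  let U : Ultrafilter ℕ := Ultrafilter.of (atTop ⊓ 𝓟 {m | ε ≤ ‖T (w m)‖})
  have hU : (U : Filter ℕ) ≤ atTop ⊓ 𝓟 {m | ε ≤ ‖T (w m)‖} := Ultrafilter.of_le _
  obtain ⟨g', hg', hgM', hgl⟩ := exists_weakStar_limit (μ := μ) U hg (norm_nonneg T) hgM
  obtain ⟨ε', hε', hint⟩ := exists_le_integral_abs_sub hw hg hgM hg' hgM' hε
    (hU.trans inf_le_left) (by
      filter_upwards [hU (mem_inf_of_right (mem_principal_self _))] with m hm
      rw [← hxg m]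
      exact hm.trans (hxw m).ge)
  have hum : ∀ n, Measurable fun t => |g n t - g' t| := fun n => ((hg n).sub hg').abs
  have hub : ∀ n t, |(|g n t - g' t|)| ≤ 2 * ‖T‖ := fun n t => by
    rw [abs_abs]
    have := abs_sub (g n t) (g' t)
    linarith [hgM n t, hgM' t]
  obtain ⟨a, ha, haM, hal⟩ := exists_weakStar_limit (μ := μ) U hum (by positivity) hub
  obtain ⟨s, hs, hs1, hst⟩ := exists_measurable_sign
  have hsm : ∀ n, Measurable fun t => s (g n t - g' t) := fun n => hs.comp ((hg n).sub hg')
  obtain ⟨s', hs', hsM', hsl⟩ := exists_weakStar_limit (μ := μ) U hsm zero_le_one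
    (fun n t => hs1 _)
  have hai : Integrable a μ := (integrable_const (2 * ‖T‖)).mono' ha.aestronglyMeasurable
    (Eventually.of_forall haM)
  have haint : ε' ≤ ∫ t, a t ∂μ := by
    obtain ⟨v, hv⟩ := exists_L1_indicator (μ := μ) MeasurableSet.univ
      (measurable_const (a := (1 : ℝ))) (M := 1) (by simp)
    have h := hal v
    simp only [integral_mul_eq_setIntegral MeasurableSet.univ hv, mul_one,
      Measure.restrict_univ] at h
    exact ge_of_tendsto h hint
  have hφm : ∀ n, Measurable fun t => (s (g n t - g' t) - s' t) / 2 := fun n =>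
    ((hsm n).sub hs').div_const 2
  have hφ1 : ∀ n t, |(s (g n t - g' t) - s' t) / 2| ≤ 1 := fun n t => by
    rw [abs_div, abs_two, div_le_one two_pos]
    exact (abs_sub _ _).trans (by linarith [hs1 (g n t - g' t), hsM' t])
  choose Φ hΦ1 hΦ using fun n =>
    exists_functional_of_bounded (μ := μ) (hφm n) zero_le_one (hφ1 n)
  have hBm : MeasurableSet {t | ε' / 2 < a t} := measurableSet_lt measurable_const ha
  refine ⟨{t | ε' / 2 < a t}, ε' / 8, ‖T‖, U, x, g, Φ, hBm, ?_, by positivity, hx1, hg, hgM, hxg,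
    hΦ1, fun v => ?_, fun A hAB hA hA0 v hv => ?_⟩
  · rw [pos_iff_ne_zero]
    intro h0
    have hae : ∀ᵐ t ∂μ, a t ≤ ε' / 2 := by
      rw [ae_iff]
      simpa using h0
    have := integral_mono_ae hai (integrable_const (ε' / 2)) hae
    simp only [integral_const, probReal_univ, smul_eq_mul, one_mul] at this
    linarith
  · have h := ((hsl v).sub (tendsto_const_nhds (x := ∫ t, s' t * v t ∂μ))).div_const 2
    rw [sub_self, zero_div] at h
    refine h.congr fun n => ?_
    rw [hΦ, ← integral_sub (integrable_bdd_mul_L1 (hsm n) (fun t => hs1 _) v)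
      (integrable_bdd_mul_L1 hs' hsM' v), ← integral_div]
    congr 1; funext t; ring
  · obtain ⟨v₁, hv₁⟩ := exists_L1_indicator (μ := μ) hA
      (measurable_const (a := (1 : ℝ))) (M := 1) (by simp)
    obtain ⟨v₂, hv₂⟩ := exists_L1_indicator (μ := μ) hA hg' hgM'
    obtain ⟨v₃, hv₃⟩ := exists_L1_indicator (μ := μ) hA hs' hsM'
    have hlim := (((hal v₁).add (hsl v₂)).sub (hgl v₃)).div_const 2
    simp only [integral_mul_eq_setIntegral hA hv₁, integral_mul_eq_setIntegral hA hv₂,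
      integral_mul_eq_setIntegral hA hv₃, mul_one] at hlim
    have hcomm : ∫ t in A, g' t * s' t ∂μ = ∫ t in A, s' t * g' t ∂μ := by
      simp only [mul_comm]
    refine ⟨(∫ t in A, a t ∂μ) / 2, ?_, ?_⟩
    · have h1 : ε' / 2 * μ.real A ≤ ∫ t in A, a t ∂μ :=
        setIntegral_ge_of_const_le_real hA (measure_ne_top μ A) (fun t ht => (hAB ht).le)
          hai.integrableOn
      have h2 : 0 < μ.real A := ENNReal.toReal_pos hA0.ne' (measure_ne_top μ A)
      nlinarith
    · rw [hcomm, add_sub_cancel_right] at hlim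
      refine hlim.congr fun n => ?_
      rw [hΦ, integral_mul_eq_setIntegral hA (hv n)]
      have hbi : ∀ {f : Ω → ℝ} {K : ℝ}, Measurable f → (∀ t, |f t| ≤ K) → IntegrableOn f A μ :=
        fun {f K} hf hK => ((integrable_const K).mono' hf.aestronglyMeasurable
          (Eventually.of_forall hK)).integrableOn
      have i1 : IntegrableOn (fun t => |g n t - g' t|) A μ := hbi (hum n) (hub n)
      have i2 : IntegrableOn (fun t => s (g n t - g' t) * g' t) A μ :=
        (hbi hg' hgM').bdd_mul (hsm n).aestronglyMeasurable (Eventually.of_forall fun t => hs1 _)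
      have i3 : IntegrableOn (fun t => g n t * s' t) A μ :=
        (hbi hs' hsM').bdd_mul (hg n).aestronglyMeasurable (Eventually.of_forall (hgM n))
      have i12 : IntegrableOn (fun t => |g n t - g' t| + s (g n t - g' t) * g' t) A μ := i1.add i2
      rw [← integral_add i1 i2, ← integral_sub i12 i3, ← integral_div]
      refine integral_congr_ae (Eventually.of_forall fun t => ?_)
      -- with `u = g n - g'`: `(s u - s') g n = |u| + s u * g' - g n * s'`
      dsimp only
      rw [← hst]; ring

end Oscillation

/-! ### Simultaneous splitting of finitely many sets -/

section Correction
variable {E : Type*} [NormedAddCommGroup E] [NormedSpace ℝ E]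

/-- Functionals that tend to `0` on finitely many vectors can be made to vanish there by subtracting
functionals that tend to `0` in norm: the evaluation map has a finite dimensional range, so a linear
right inverse on it is continuous. -/
theorem exists_linear_correction {ι : Type*} [Finite ι] (v : ι → E) (U : Filter ℕ)
    {Φ : ℕ → StrongDual ℝ E} (hΦ : ∀ i, Tendsto (fun n => Φ n (v i)) U (𝓝 0)) :
    ∃ c : ℕ → StrongDual ℝ E, Tendsto (fun n => ‖c n‖) U (𝓝 0) ∧
      ∀ n i, c n (v i) = Φ n (v i) := by
  have := Fintype.ofFinite ι
  let Λ : StrongDual ℝ E →ₗ[ℝ] (ι → ℝ) :=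
    LinearMap.pi fun i => (ContinuousLinearMap.apply ℝ ℝ (v i)).toLinearMap
  have hΛ : ∀ F i, Λ F i = F (v i) := fun F i => rfl
  obtain ⟨R, hR⟩ := Λ.rangeRestrict.exists_rightInverse_of_surjective
    (LinearMap.range_rangeRestrict Λ)
  have hRc : Continuous R := LinearMap.continuous_of_finiteDimensional R
  have h0 : Tendsto (fun n => Λ.rangeRestrict (Φ n)) U (𝓝 0) := by
    rw [tendsto_subtype_rng]
    refine tendsto_pi_nhds.2 fun i => ?_
    exact hΦ i
  refine ⟨fun n => R (Λ.rangeRestrict (Φ n)), ?_, fun n i => ?_⟩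
  · have := (hRc.tendsto 0).comp h0
    rw [map_zero] at this
    exact tendsto_zero_iff_norm_tendsto_zero.1 this
  · have h := LinearMap.congr_fun hR (Λ.rangeRestrict (Φ n))
    have h' := congrArg Subtype.val h
    exact congrFun h' i

end Correction

open Classical in
/-- The class in `L₁` of the indicator function of a set (`0` if the set is not Lebesgue
measurable). -/
noncomputable def indL1 (A : Set unitInterval) : L1 :=
  if h : NullMeasurableSet A volume then (DyadicSplitting.memLp_indicator h).toLp _ else 0

theorem coeFn_indL1 {A : Set unitInterval} (hA : NullMeasurableSet A volume) :
    indL1 A =ᵐ[volume] A.indicator fun _ => (1 : ℝ) := by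
  rw [indL1, dif_pos hA]
  exact MemLp.coeFn_toLp _

/-- Integration against `1_{A ∩ E} - 1_{A \ E}`. -/
theorem apply_indL1_inter_sub_diff {F : StrongDual ℝ L1} {g : unitInterval → ℝ}
    (hF : ∀ w, F w = ∫ t, g t * w t) {A E : Set unitInterval} (hA : MeasurableSet A)
    (hE : MeasurableSet E) {v : L1} (hv : v =ᵐ[volume] A.indicator g) :
    F (indL1 (A ∩ E) - indL1 (A \ E)) = (∫ x in E, v x) - ∫ x in Eᶜ, v x := by
  have hi := L1.integrable_coeFn v
  rw [hF, ← integral_indicator hE, ← integral_indicator hE.compl,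
    ← integral_sub (hi.indicator hE) (hi.indicator hE.compl)]
  refine integral_congr_ae ?_
  filter_upwards [hv, coeFn_indL1 (hA.inter hE).nullMeasurableSet,
    coeFn_indL1 (hA.diff hE).nullMeasurableSet,
    Lp.coeFn_sub (indL1 (A ∩ E)) (indL1 (A \ E))] with x h1 h2 h3 h4
  rw [h4, Pi.sub_apply, h2, h3]
  by_cases ha : x ∈ A <;> by_cases he : x ∈ E <;> simp [ha, he, h1]

/-- Finitely many subsets of `B` of positive measure can be halved by one set `E`, so that a norm
one functional `x` is larger than `δ` times the measure on the image of each `1_{A ∩ E} - 1_{A \ E}`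
while finitely many prescribed functionals vanish there. `κ` is a finite index set for the subsets,
which need not be disjoint. -/
def SplitsSubsetsWith {X : Type*} [NormedAddCommGroup X] [NormedSpace ℝ X] (T : L1 →L[ℝ] X)
    (B : Set unitInterval) (δ : ℝ) : Prop :=
  ∀ (κ : Type) [Finite κ] (A : κ → Set unitInterval), (∀ k, MeasurableSet (A k)) →
      (∀ k, A k ⊆ B) → (∀ k, 0 < volume (A k)) → ∀ Y : Finset (StrongDual ℝ X),
      ∃ (x : StrongDual ℝ X) (E : Set unitInterval), ‖x‖ = 1 ∧ MeasurableSet E ∧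
        ∀ k, volume (A k ∩ E) = volume (A k \ E) ∧
          δ * volume.real (A k) < x (T (indL1 (A k ∩ E) - indL1 (A k \ E))) ∧
          ∀ y ∈ Y, y (T (indL1 (A k ∩ E) - indL1 (A k \ E))) = 0

/-- The functionals `Φ n` that detect oscillation, corrected to vanish on the `1_A` and on the
`1_A · (y ∘ T)` and renormalized, become signs by Lyapunov's theorem. -/
theorem exists_simultaneous_splitting {X : Type*} [NormedAddCommGroup X] [NormedSpace ℝ X]
    {T : L1 →L[ℝ] X} (hT : ¬ IsCompletelyContinuous T) :
    ∃ (B : Set unitInterval) (δ : ℝ), MeasurableSet B ∧ 0 < volume B ∧ 0 < δ ∧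
      SplitsSubsetsWith T B δ := by
  obtain ⟨B, c, M, U, x, g, Φ, hB, hB0, hc, hx1, hg, hgM, hxg, hΦ1, hΦ0, hΦ⟩ :=
    exists_oscillating_functionals hT
  refine ⟨B, c, hB, hB0, hc, fun κ _ A hA hAB hA0 Y => ?_⟩
  have := Fintype.ofFinite κ
  choose d hd hdF hdi using fun F : StrongDual ℝ L1 => exists_density F
  choose v hv using fun (y : Y) (k : κ) => exists_L1_indicator (μ := volume) (hA k)
    (hd (y.1.comp T)) (hdF _)
  choose w hw using fun (n : ℕ) (k : κ) => exists_L1_indicator (μ := volume) (hA k) (hg n) (hgM n)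
  let z : κ ⊕ (Y × κ) → L1 := Sum.elim (fun k => indL1 (A k)) (fun p => v p.1 p.2)
  obtain ⟨e, he0, he⟩ := exists_linear_correction z U (Φ := Φ) (fun i => hΦ0 _)
  have hwM : ∀ n k, ‖w n k‖ ≤ |M| := by
    intro n k
    rw [L1.norm_eq_integral_norm]
    have h : ∀ᵐ t : unitInterval, ‖w n k t‖ ≤ |M| := by
      filter_upwards [hw n k] with t ht
      rw [ht]
      by_cases h : t ∈ A k
      · simpa [h] using (hgM n t).trans (le_abs_self M)
      · simp [h]
    have := integral_mono_ae (L1.integrable_coeFn (w n k)).norm (integrable_const |M|) h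
    simpa using this
  -- the corrected and renormalized functionals are still large on `1_A g_n`
  have hbig : ∀ k, ∀ᶠ n in (U : Filter ℕ), c * volume.real (A k)
      < (1 + ‖e n‖)⁻¹ * (Φ n (w n k) - e n (w n k)) := by
    intro k
    obtain ⟨l, hl, hlim⟩ := hΦ (A k) (hAB k) (hA k) (hA0 k) (fun n => w n k) (fun n => hw n k)
    have h1 : Tendsto (fun n => e n (w n k)) U (𝓝 0) := by
      refine squeeze_zero_norm (fun n => ((e n).le_opNorm _).trans
        (mul_le_mul_of_nonneg_left (hwM n k) (norm_nonneg _))) ?_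
      simpa using he0.mul_const |M|
    have h2 : Tendsto (fun n => (1 + ‖e n‖)⁻¹) U (𝓝 1) := by
      have := (he0.const_add 1).inv₀ (by norm_num)
      simpa using this
    have h3 := h2.mul (hlim.sub h1)
    rw [one_mul, sub_zero] at h3
    exact h3.eventually_const_lt hl
  obtain ⟨n, hn⟩ := (eventually_all.2 hbig).exists
  have hpos : 0 < 1 + ‖e n‖ := by positivity
  obtain ⟨E, hE, hEi⟩ := exists_set_of_functional
    (Sum.elim z (w n)) ((1 + ‖e n‖)⁻¹ • (Φ n - e n)) (by
      rw [norm_smul, norm_inv, Real.norm_of_nonneg hpos.le, inv_mul_le_iff₀ hpos, mul_one]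
      exact (norm_sub_le _ _).trans (by linarith [hΦ1 n]))
  have hz : ∀ i, (∫ t in E, z i t) - ∫ t in Eᶜ, z i t = 0 := by
    intro i
    refine (hEi (Sum.inl i)).trans ?_
    simp [he n i]
  refine ⟨x n, E, hx1 n, hE, fun k => ⟨?_, ?_, fun y hy => ?_⟩⟩
  · have h := hz (Sum.inl k)
    have h1 : ∀ S : Set unitInterval, MeasurableSet S →
        ∫ t in S, z (Sum.inl k) t = volume.real (A k ∩ S) := by
      intro S hS
      have : ∫ t in S, z (Sum.inl k) t = ∫ t in S, (A k).indicator (fun _ => (1 : ℝ)) t :=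
        integral_congr_ae (ae_restrict_of_ae (coeFn_indL1 (hA k).nullMeasurableSet))
      rw [this, setIntegral_indicator (hA k), Set.inter_comm]
      simp
    rw [h1 E hE, h1 Eᶜ hE.compl, sub_eq_zero] at h
    rw [Set.sdiff_eq]
    exact (measureReal_eq_measureReal_iff (measure_ne_top _ _) (measure_ne_top _ _)).1 h
  · refine (hn k).trans_eq ?_
    have h := apply_indL1_inter_sub_diff (F := (x n).comp T) (fun w => hxg n w) (hA k) hE (hw n k)
    refine Eq.trans ?_ h.symm
    refine Eq.trans ?_ (hEi (Sum.inr k)).symm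
    simp
  · have h := apply_indL1_inter_sub_diff (hdi (y.comp T)) (hA k) hE (hv ⟨y, hy⟩ k)
    exact h.trans (hz (Sum.inr (⟨y, hy⟩, k)))

/-! ### Finite norming sets -/

/-- Norming functionals of the points of a finite net of the unit sphere suffice, by
compactness. -/
theorem exists_finset_normsWithin {X : Type*} [NormedAddCommGroup X] [NormedSpace ℝ X]
    [Nontrivial X] (V : Submodule ℝ X) [FiniteDimensional ℝ V] {τ : ℝ} (hτ : 1 < τ) :
    ∃ Y : Finset (StrongDual ℝ X), NormsWithin (Y : Set (StrongDual ℝ X)) V τ := by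
  classical
  choose f hf1 hf using fun x : X => exists_dual_vector' ℝ x
  have hf' : ∀ x, f x x = ‖x‖ := fun x => by simpa using hf x
  have hc : IsCompact (((↑) : V → X) '' Metric.sphere (0 : V) 1) :=
    (isCompact_sphere (0 : V) 1).image continuous_subtype_val
  -- at a unit vector `x`, `τ * f x x = τ > 1`, so the inequality persists near `x`
  obtain ⟨t, -, hcov⟩ := hc.elim_nhds_subcover (fun x => {y | ‖y‖ < τ * f x y}) (by
    rintro _ ⟨x, hx, rfl⟩
    refine (isOpen_lt continuous_norm ((f x).continuous.const_mul τ)).mem_nhds ?_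
    have hx1 : ‖(x : X)‖ = 1 := by simpa using hx
    simp only [Set.mem_ofPred_eq, hf', hx1]
    linarith)
  -- the point `0` keeps the set nonempty when the subspace is trivial
  refine ⟨(insert 0 t).image f, ?_, fun x hx => ?_⟩
  · intro φ hφ
    obtain ⟨x, -, rfl⟩ := Finset.mem_image.1 (Finset.mem_coe.1 hφ)
    exact hf1 x
  · rcases eq_or_ne x 0 with rfl | hx0
    · exact ⟨f 0, by simp, by simp⟩
    · have hn : 0 < ‖x‖ := norm_pos_iff.2 hx0
      have hmem : ‖x‖⁻¹ • x ∈ ((↑) : V → X) '' Metric.sphere (0 : V) 1 :=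
        ⟨⟨‖x‖⁻¹ • x, V.smul_mem _ hx⟩, by simp [norm_smul, hn.ne'], rfl⟩
      obtain ⟨y, hy, hlt⟩ := Set.mem_iUnion₂.1 (hcov hmem)
      refine ⟨f y, Finset.mem_coe.2 (Finset.mem_image_of_mem f (Finset.mem_insert_of_mem hy)), ?_⟩
      have h2 : ‖‖x‖⁻¹ • x‖ < τ * f y (‖x‖⁻¹ • x) := hlt
      rw [norm_smul, map_smul, smul_eq_mul, norm_inv, norm_norm] at h2
      have h3 : ‖x‖⁻¹ * ‖x‖ ≤ ‖x‖⁻¹ * (τ * f y x) := by linarith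
      exact le_of_mul_le_mul_left h3 (inv_pos.2 hn)

/-! ### The Haar system in terms of indicator functions -/

theorem indL1_union {A B : Set unitInterval} (hA : NullMeasurableSet A volume)
    (hB : NullMeasurableSet B volume) (h : Disjoint A B) :
    indL1 (A ∪ B) = indL1 A + indL1 B := by
  refine Lp.ext ?_
  filter_upwards [coeFn_indL1 hA, coeFn_indL1 hB, coeFn_indL1 (hA.union hB),
    Lp.coeFn_add (indL1 A) (indL1 B)] with x h1 h2 h3 h4
  rw [h4, Pi.add_apply, h1, h2, h3, Set.indicator_union_of_disjoint h]

namespace DyadicSplitting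
variable (S : DyadicSplitting)

theorem nullMeasurable_left {n k : ℕ} (hk : 1 ≤ k) (hk' : k ≤ 2 ^ n) :
    NullMeasurableSet (S.A (n + 1) (2 * k - 1)) volume :=
  S.nullMeasurable _ _ (by omega) (by rw [pow_succ]; omega)

theorem nullMeasurable_right {n k : ℕ} (hk : 1 ≤ k) (hk' : k ≤ 2 ^ n) :
    NullMeasurableSet (S.A (n + 1) (2 * k)) volume :=
  S.nullMeasurable _ _ (by omega) (by rw [pow_succ]; omega)

theorem haar_one : S.haar 1 = (1 / volume.real (S.A 0 1)) • indL1 (S.A 0 1) := by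
  refine Lp.ext ?_
  filter_upwards [MemLp.coeFn_toLp (S.memLp_haarFun 1),
    coeFn_indL1 (S.nullMeasurable 0 1 le_rfl (by simp)),
    Lp.coeFn_smul (1 / volume.real (S.A 0 1)) (indL1 (S.A 0 1))] with x h1 h2 h3
  rw [haar, h1, h3, Pi.smul_apply, h2, haarFun_one, smul_eq_mul]

theorem haar_two_pow_add {n k : ℕ} (hk : 1 ≤ k) (hk' : k ≤ 2 ^ n) :
    S.haar (2 ^ n + k) = (2 ^ n / volume.real (S.A 0 1)) •
      (indL1 (S.A (n + 1) (2 * k - 1)) - indL1 (S.A (n + 1) (2 * k))) := by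
  refine Lp.ext ?_
  filter_upwards [MemLp.coeFn_toLp (S.memLp_haarFun (2 ^ n + k)),
    coeFn_indL1 (S.nullMeasurable_left hk hk'), coeFn_indL1 (S.nullMeasurable_right hk hk'),
    Lp.coeFn_sub (indL1 (S.A (n + 1) (2 * k - 1))) (indL1 (S.A (n + 1) (2 * k))),
    Lp.coeFn_smul (2 ^ n / volume.real (S.A 0 1))
      (indL1 (S.A (n + 1) (2 * k - 1)) - indL1 (S.A (n + 1) (2 * k)))] with x h1 h2 h3 h4 h5
  rw [haar, h1, h5, Pi.smul_apply, h4, Pi.sub_apply, h2, h3, haarFun_two_pow_add S n k hk hk',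
    haarLevel, smul_eq_mul]

end DyadicSplitting

/-- The span of the images of the indicator functions of the sets `A 1, …, A (2 ^ n)` of one
level. -/
noncomputable def levelSpan {X : Type*} [NormedAddCommGroup X] [NormedSpace ℝ X]
    (T : L1 →L[ℝ] X) (A : ℕ → Set unitInterval) (n : ℕ) : Submodule ℝ X :=
  Submodule.span ℝ ((fun k => T (indL1 (A k))) '' (Finset.Icc 1 (2 ^ n) : Finset ℕ))

section Span
variable {X : Type*} [NormedAddCommGroup X] [NormedSpace ℝ X] (T : L1 →L[ℝ] X)

instance finiteDimensional_levelSpan (A : ℕ → Set unitInterval) (n : ℕ) :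
    FiniteDimensional ℝ (levelSpan T A n) :=
  FiniteDimensional.span_of_finite ℝ ((Finset.finite_toSet _).image _)

theorem mem_levelSpan {A : ℕ → Set unitInterval} {n k : ℕ} (hk : 1 ≤ k) (hk' : k ≤ 2 ^ n) :
    T (indL1 (A k)) ∈ levelSpan T A n :=
  Submodule.subset_span ⟨k, by simp [hk, hk'], rfl⟩

theorem levelSpan_le_succ (S : DyadicSplitting) (n : ℕ) :
    levelSpan T (S.A n) n ≤ levelSpan T (S.A (n + 1)) (n + 1) := by
  refine Submodule.span_le.2 ?_
  rintro _ ⟨k, hk, rfl⟩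
  obtain ⟨hk, hk'⟩ := Finset.mem_Icc.1 (Finset.mem_coe.1 hk)
  dsimp only
  rw [← S.union_eq n k hk hk', indL1_union (S.nullMeasurable_left hk hk')
    (S.nullMeasurable_right hk hk') (S.disjoint n k hk hk'), map_add]
  exact add_mem (mem_levelSpan T (by omega) (by rw [pow_succ]; omega))
    (mem_levelSpan T (by omega) (by rw [pow_succ]; omega))

/-- The Haar functions of index at most `2 ^ n` are combinations of the indicator functions of the
sets of level `n`, so a set that norms their span can be chosen from level `n` alone. -/
theorem initialSpan_le_levelSpan (S : DyadicSplitting) (n : ℕ) :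
    initialSpan T S n ≤ levelSpan T (S.A n) n := by
  induction n with
  | zero =>
    refine Submodule.span_le.2 ?_
    rintro _ ⟨j, hj, hj', rfl⟩
    obtain rfl : j = 1 := le_antisymm (by simpa using hj') hj
    rw [S.haar_one, map_smul]
    exact Submodule.smul_mem _ _ (mem_levelSpan T le_rfl (by simp))
  | succ n ih =>
    refine Submodule.span_le.2 ?_
    rintro _ ⟨j, hj, hj', rfl⟩
    rcases le_or_gt j (2 ^ n) with h | h
    · exact levelSpan_le_succ T S n (ih (Submodule.subset_span ⟨j, hj, h, rfl⟩))
    · obtain ⟨k, rfl⟩ := Nat.exists_eq_add_of_lt h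
      have hk : k + 1 ≤ 2 ^ n := by rw [pow_succ] at hj'; omega
      rw [add_assoc, S.haar_two_pow_add (by omega) hk, map_smul, map_sub]
      exact Submodule.smul_mem _ _ (sub_mem
        (mem_levelSpan T (by omega) (by rw [pow_succ]; omega))
        (mem_levelSpan T (by omega) (by rw [pow_succ]; omega)))

end Span

/-! ### Construction of the dyadic splitting -/

/-- The sets `A 1, …, A (2 ^ n)` are measurable subsets of `B` of measure `μ(B) / 2 ^ n`. -/
def IsLevel (B : Set unitInterval) (n : ℕ) (A : ℕ → Set unitInterval) : Prop :=
  ∀ k, 1 ≤ k → k ≤ 2 ^ n →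
    MeasurableSet (A k) ∧ A k ⊆ B ∧ volume.real (A k) = volume.real B / 2 ^ n

theorem exists_next_level {X : Type*} [NormedAddCommGroup X] [NormedSpace ℝ X] [Nontrivial X]
    {T : L1 →L[ℝ] X} {B : Set unitInterval} {δ : ℝ} (hB0 : 0 < volume B)
    (hsplit : SplitsSubsetsWith T B δ)
    {τ : ℝ} (hτ : 1 < τ) (n : ℕ) (A : ℕ → Set unitInterval) (hA : IsLevel B n A) :
    ∃ (A' : ℕ → Set unitInterval) (x : StrongDual ℝ X) (Y : Finset (StrongDual ℝ X)),
      IsLevel B (n + 1) A' ∧ ‖x‖ = 1 ∧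
      NormsWithin (Y : Set (StrongDual ℝ X)) (levelSpan T A n) τ ∧
      ∀ k, 1 ≤ k → k ≤ 2 ^ n → A' (2 * k - 1) ∪ A' (2 * k) = A k ∧
        Disjoint (A' (2 * k - 1)) (A' (2 * k)) ∧
        volume (A' (2 * k - 1)) = volume (A' (2 * k)) ∧
        δ * volume.real (A k) < x (T (indL1 (A' (2 * k - 1)) - indL1 (A' (2 * k)))) ∧
        ∀ y ∈ Y, y (T (indL1 (A' (2 * k - 1)) - indL1 (A' (2 * k)))) = 0 := by
  obtain ⟨Y, hY⟩ := exists_finset_normsWithin (levelSpan T A n) hτ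
  have hBr : 0 < volume.real B := ENNReal.toReal_pos hB0.ne' (measure_ne_top _ _)
  have hκ : ∀ k : Finset.Icc 1 (2 ^ n), 1 ≤ k.1 ∧ k.1 ≤ 2 ^ n := fun k => Finset.mem_Icc.1 k.2
  obtain ⟨x, E, hx, hE, hsp⟩ := hsplit (Finset.Icc 1 (2 ^ n)) (fun k => A k.1)
    (fun k => (hA k (hκ k).1 (hκ k).2).1) (fun k => (hA k (hκ k).1 (hκ k).2).2.1)
    (fun k => by
      have h : 0 < volume.real (A k.1) := by
        rw [(hA k (hκ k).1 (hκ k).2).2.2]; positivity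
      exact (ENNReal.toReal_pos_iff.1 h).1) Y
  let A' : ℕ → Set unitInterval := fun j =>
    if Even j then A ((j + 1) / 2) \ E else A ((j + 1) / 2) ∩ E
  have hodd : ∀ k, 1 ≤ k → A' (2 * k - 1) = A k ∩ E := fun k hk => by
    have h1 : ¬ Even (2 * k - 1) := by rw [Nat.not_even_iff]; omega
    have h2 : (2 * k - 1 + 1) / 2 = k := by omega
    simp only [A', h1, h2, if_false]
  have heven : ∀ k, A' (2 * k) = A k \ E := fun k => by
    have h2 : (2 * k + 1) / 2 = k := by omega
    simp only [A', even_two_mul, h2, if_true]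
  have hsp' := fun (k : ℕ) (hk : 1 ≤ k) (hk' : k ≤ 2 ^ n) => hsp ⟨k, Finset.mem_Icc.2 ⟨hk, hk'⟩⟩
  refine ⟨A', x, Y, fun j hj hj' => ?_, hx, hY, fun k hk hk' => ?_⟩
  · obtain ⟨k, hk, hk', hjk⟩ : ∃ k, 1 ≤ k ∧ k ≤ 2 ^ n ∧ (j = 2 * k - 1 ∨ j = 2 * k) :=
      ⟨(j + 1) / 2, by omega, by rw [pow_succ] at hj'; omega, by omega⟩
    obtain ⟨hm, hs, hv⟩ := hA k hk hk'
    have h1 := measureReal_inter_add_sdiff (μ := volume) (s := A k) hE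
    have h2 : volume.real (A k ∩ E) = volume.real (A k \ E) := by
      rw [Measure.real, (hsp' k hk hk').1, Measure.real]
    have h3 : volume.real B / 2 ^ (n + 1) = volume.real B / 2 ^ n / 2 := by
      rw [pow_succ, div_div]
    rcases hjk with rfl | rfl
    · rw [hodd k hk]
      exact ⟨hm.inter hE, Set.inter_subset_left.trans hs, by rw [h3]; linarith⟩
    · rw [heven k]
      exact ⟨hm.diff hE, Set.sdiff_subset.trans hs, by rw [h3]; linarith⟩
  · rw [hodd k hk, heven k]
    exact ⟨Set.inter_union_sdiff _ _, Set.disjoint_sdiff_inter.symm, hsp' k hk hk'⟩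

theorem exists_dyadicSplitting {X : Type*} [NormedAddCommGroup X] [NormedSpace ℝ X]
    {T : L1 →L[ℝ] X} (hT : ¬ IsCompletelyContinuous T) {τ : ℕ → ℝ} (hτ : ∀ n, 1 < τ n) :
    ∃ (S : DyadicSplitting) (x : ℕ → StrongDual ℝ X) (Y : ℕ → Finset (StrongDual ℝ X)),
      (∀ n, ‖x n‖ = 1) ∧
      ∃ δ : ℝ, 0 < δ ∧ ∀ n : ℕ,
        (∀ k : ℕ, 1 ≤ k → k ≤ 2 ^ n → δ < x n (T (S.haar (2 ^ n + k)))) ∧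
        NormsWithin (Y n : Set (StrongDual ℝ X)) (initialSpan T S n) (τ n) ∧
        (∀ y ∈ Y n, ∀ k : ℕ, 1 ≤ k → k ≤ 2 ^ n → y (T (S.haar (2 ^ n + k))) = 0) := by
  obtain ⟨B, δ, hB, hB0, hδ, hsplit⟩ := exists_simultaneous_splitting hT
  have : Nontrivial X := by
    by_contra h
    rw [not_nontrivial_iff_subsingleton] at h
    exact hT fun f g _ => ⟨0, by simp [Subsingleton.elim _ (0 : X)]⟩
  choose! A' x Y hA' hx hY hrel using fun n A (hA : IsLevel B n A) =>
    exists_next_level hB0 hsplit (hτ n) n A hA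
  let A : ℕ → ℕ → Set unitInterval := fun n => Nat.rec (fun _ => B) A' n
  have hA0 : ∀ k, A 0 k = B := fun k => rfl
  have hA : ∀ n, IsLevel B n (A n) := by
    intro n
    induction n with
    | zero => exact fun k _ _ => ⟨hB, subset_rfl, by simp [hA0]⟩
    | succ n ih => exact hA' n _ ih
  let S : DyadicSplitting :=
    { A := A
      nullMeasurable := fun n k hk hk' => (hA n k hk hk').1.nullMeasurableSet
      pos := hB0
      union_eq := fun n k hk hk' => (hrel n _ (hA n) k hk hk').1
      disjoint := fun n k hk hk' => (hrel n _ (hA n) k hk hk').2.1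
      measure_eq := fun n k hk hk' => (hrel n _ (hA n) k hk hk').2.2.1 }
  have hBr : 0 < volume.real B := ENNReal.toReal_pos hB0.ne' (measure_ne_top _ _)
  have hhaar : ∀ n k, 1 ≤ k → k ≤ 2 ^ n → ∀ f : StrongDual ℝ X,
      f (T (S.haar (2 ^ n + k))) = 2 ^ n / volume.real B *
        f (T (indL1 (A' n (A n) (2 * k - 1)) - indL1 (A' n (A n) (2 * k)))) := by
    intro n k hk hk' f
    rw [S.haar_two_pow_add hk hk', map_smul, map_smul, smul_eq_mul]
    rfl
  refine ⟨S, fun n => x n (A n), fun n => Y n (A n), fun n => hx n _ (hA n), δ, hδ, fun n =>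
    ⟨fun k hk hk' => ?_, ⟨(hY n _ (hA n)).1, fun v hv => (hY n _ (hA n)).2 v
      (initialSpan_le_levelSpan T S n hv)⟩, fun y hy k hk hk' => ?_⟩⟩
  · have h := (hrel n _ (hA n) k hk hk').2.2.2.1
    rw [(hA n k hk hk').2.2] at h
    rw [hhaar n k hk hk']
    have h2 : δ = 2 ^ n / volume.real B * (δ * (volume.real B / 2 ^ n)) := by field_simp
    calc δ = 2 ^ n / volume.real B * (δ * (volume.real B / 2 ^ n)) := h2
      _ < _ := mul_lt_mul_of_pos_left h (by positivity)
  · rw [hhaar n k hk hk', (hrel n _ (hA n) k hk hk').2.2.2.2 y hy, mul_zero]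

/-! ### Finite dimensional decompositions -/

section Decomposition
variable {X : Type*} [NormedAddCommGroup X] [NormedSpace ℝ X]

theorem exists_finite_expansion {V : ℕ → Submodule ℝ X} {x : X} (hx : x ∈ ⨆ n, V n) :
    ∃ (v : ℕ → X) (N : ℕ), (∀ n, v n ∈ V n) ∧ ∀ m ≥ N, ∑ n ∈ Finset.range m, v n = x := by
  induction hx using Submodule.iSup_induction' with
  | mem i x hx =>
    refine ⟨Pi.single i x, i + 1, fun n => ?_, fun m hm => ?_⟩
    · rcases eq_or_ne n i with rfl | h
      · simpa using hx
      · simp [h]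
    · rw [Finset.sum_eq_single_of_mem i (Finset.mem_range.2 (by omega))
        fun n _ h => Pi.single_eq_of_ne h _, Pi.single_eq_same]
  | zero => exact ⟨0, 0, fun n => zero_mem _, by simp⟩
  | add x y _ _ hx hy =>
    obtain ⟨v, N, hv, hvN⟩ := hx
    obtain ⟨w, M, hw, hwM⟩ := hy
    refine ⟨v + w, max N M, fun n => add_mem (hv n) (hw n), fun m hm => ?_⟩
    simp only [Pi.add_apply, Finset.sum_add_distrib]
    rw [hvN m (by omega), hwM m (by omega)]

/-- Grünblum's criterion for decompositions: it suffices that the norms of partial sums are monotone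
up to the factor `K`. Expansions of approximants of `x` converge coordinatewise, uniformly for all
partial sums, and the limit is the expansion of `x`. -/
theorem isFDDWithConstantLE_of_norm_partialSum_le [CompleteSpace X] {V : ℕ → Submodule ℝ X}
    (hV : ∀ n, FiniteDimensional ℝ (V n)) {K : ℝ}
    (hK : ∀ v : ℕ → X, (∀ n, v n ∈ V n) → ∀ N M, N ≤ M →
      ‖∑ n ∈ Finset.range N, v n‖ ≤ K * ‖∑ n ∈ Finset.range M, v n‖) :
    IsFDDWithConstantLE V K := by
  have hlim : ∀ (x : X) (v : ℕ → X), (∀ n, v n ∈ V n) →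
      Tendsto (fun N => ∑ n ∈ Finset.range N, v n) atTop (𝓝 x) →
        ∀ N, ‖∑ n ∈ Finset.range N, v n‖ ≤ K * ‖x‖ := fun x v hv hx N =>
    ge_of_tendsto (hx.norm.const_mul K) (by
      filter_upwards [eventually_ge_atTop N] with M hM using hK v hv N M hM)
  have huniq : ∀ (x : X) (v w : ℕ → X), (∀ n, v n ∈ V n) → (∀ n, w n ∈ V n) →
      Tendsto (fun N => ∑ n ∈ Finset.range N, v n) atTop (𝓝 x) →
      Tendsto (fun N => ∑ n ∈ Finset.range N, w n) atTop (𝓝 x) → w = v := by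
    intro x v w hv hw hvx hwx
    have h := hwx.sub hvx
    simp only [← Finset.sum_sub_distrib, sub_self] at h
    have h0 : ∀ N, ∑ n ∈ Finset.range N, (w n - v n) = 0 := fun N => by
      simpa using hlim 0 (fun n => w n - v n) (fun n => sub_mem (hw n) (hv n)) h N
    funext n
    have h1 := h0 (n + 1)
    rw [Finset.sum_range_succ, h0 n, zero_add] at h1
    exact sub_eq_zero.1 h1
  refine ⟨hV, fun x hx => ?_, hlim⟩
  obtain ⟨y, hyV, hyx⟩ := mem_closure_iff_seq_limit.1 hx
  choose u L hu hL using fun j => exists_finite_expansion (hyV j)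
  have hpart : ∀ i j N, ‖∑ n ∈ Finset.range N, u i n - ∑ n ∈ Finset.range N, u j n‖
      ≤ K * ‖y i - y j‖ := by
    intro i j N
    have h := hK (fun n => u i n - u j n) (fun n => sub_mem (hu i n) (hu j n)) N
      (max N (max (L i) (L j))) (le_max_left _ _)
    simp only [Finset.sum_sub_distrib] at h
    rwa [hL i (max N (max (L i) (L j))) (by omega), hL j (max N (max (L i) (L j))) (by omega)] at h
  have hcoord : ∀ i j n, ‖u i n - u j n‖ ≤ 2 * K * ‖y i - y j‖ := by
    intro i j n
    have h1 := hpart i j (n + 1)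
    have h2 := hpart i j n
    have e : u i n - u j n = (∑ m ∈ Finset.range (n + 1), u i m - ∑ m ∈ Finset.range (n + 1), u j m)
        - (∑ m ∈ Finset.range n, u i m - ∑ m ∈ Finset.range n, u j m) := by
      rw [Finset.sum_range_succ, Finset.sum_range_succ]; abel
    rw [e]
    exact (norm_sub_le _ _).trans (by linarith)
  have hcau : ∀ n, ∃ s, Tendsto (fun j => u j n) atTop (𝓝 s) := by
    intro n
    refine cauchySeq_tendsto_of_complete (Metric.cauchySeq_iff.2 fun ε hε => ?_)
    have hK0 : 0 < 2 * |K| + 1 := by positivity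
    obtain ⟨J, hJ⟩ := Metric.cauchySeq_iff.1 hyx.cauchySeq (ε / (2 * |K| + 1)) (by positivity)
    refine ⟨J, fun i hi j hj => ?_⟩
    have h := hJ i hi j hj
    rw [lt_div_iff₀ hK0, dist_eq_norm] at h
    rw [dist_eq_norm]
    refine (hcoord i j n).trans_lt (lt_of_le_of_lt ?_ h)
    rw [mul_comm]
    exact mul_le_mul_of_nonneg_left (by linarith [le_abs_self K]) (norm_nonneg _)
  choose v hv using hcau
  have hvV : ∀ n, v n ∈ V n := fun n =>
    have := hV n
    (V n).closed_of_finiteDimensional.mem_of_tendsto (hv n) (Eventually.of_forall fun j => hu j n)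
  have hclose : ∀ N j, ‖∑ n ∈ Finset.range N, v n - ∑ n ∈ Finset.range N, u j n‖
      ≤ K * ‖x - y j‖ := fun N j =>
    le_of_tendsto_of_tendsto'
      (((tendsto_finsetSum _ fun n _ => hv n).sub_const (∑ n ∈ Finset.range N, u j n)).norm)
      ((hyx.sub_const (y j)).norm.const_mul K) fun i => hpart i j N
  have hvx : Tendsto (fun N => ∑ n ∈ Finset.range N, v n) atTop (𝓝 x) := by
    refine Metric.tendsto_atTop.2 fun ε hε => ?_
    have hK0 : 0 < |K| + 1 := by positivity
    obtain ⟨j, hj⟩ := (Metric.tendsto_atTop.1 hyx (ε / (|K| + 1)) (by positivity))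
    have hj := hj j le_rfl
    rw [lt_div_iff₀ hK0, dist_comm, dist_eq_norm] at hj
    refine ⟨L j, fun N hN => ?_⟩
    have h1 := hclose N j
    rw [hL j N hN] at h1
    rw [dist_eq_norm]
    have h2 := norm_sub_le_norm_sub_add_norm_sub (∑ n ∈ Finset.range N, v n) (y j) x
    have h3 : K * ‖x - y j‖ ≤ |K| * ‖x - y j‖ :=
      mul_le_mul_of_nonneg_right (le_abs_self K) (norm_nonneg _)
    rw [norm_sub_rev (y j) x] at h2
    linarith
  exact ⟨v, ⟨hvV, hvx⟩, fun w ⟨hwV, hw⟩ => huniq x v w hvV hwV hvx hw⟩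

/-- A functional that almost norms the first `N + 1` blocks vanishes on the next one, so adding that
block decreases the norm at most by the factor `τ N`; the factors multiply to at most `P`. -/
theorem isFDDWithConstantLE_haarBlock [CompleteSpace X] {T : L1 →L[ℝ] X} {τ : ℕ → ℝ}
    (hτ : ∀ n, 1 < τ n) (S : DyadicSplitting) (Y : ℕ → Finset (StrongDual ℝ X))
    (hY : ∀ n, NormsWithin (Y n : Set (StrongDual ℝ X)) (initialSpan T S n) (τ n) ∧
      ∀ y ∈ Y n, ∀ k : ℕ, 1 ≤ k → k ≤ 2 ^ n → y (T (S.haar (2 ^ n + k))) = 0)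
    {P : ℝ} (hP : Tendsto (fun N => ∏ n ∈ Finset.range N, τ n) atTop (𝓝 P)) :
    IsFDDWithConstantLE (haarBlock T S) P := by
  have hprod0 : ∀ N, 1 ≤ ∏ n ∈ Finset.range N, τ n := fun N => by
    simpa using Finset.prod_le_prod (s := Finset.range N) (f := fun _ => (1 : ℝ)) (g := τ)
      (fun _ _ => zero_le_one) fun n _ => (hτ n).le
  have hmono : Monotone fun N => ∏ n ∈ Finset.range N, τ n := monotone_nat_of_le_succ fun N => by
    rw [Finset.prod_range_succ]
    exact le_mul_of_one_le_right (zero_le_one.trans (hprod0 N)) (hτ N).le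
  have hP1 : ∀ N, ∏ n ∈ Finset.range N, τ n ≤ P := fun N => hmono.ge_of_tendsto hP N
  have hP0 : 0 ≤ P := zero_le_one.trans ((hprod0 0).trans (hP1 0))
  have hblock : ∀ n N, n ≤ N → haarBlock T S n ≤ initialSpan T S N := by
    refine fun n N h => Submodule.span_mono ?_
    rintro x ⟨j, hj, hj', rfl⟩
    exact ⟨j, by have := Nat.one_le_two_pow (n := n); omega,
      hj'.trans (Nat.pow_le_pow_right two_pos h), rfl⟩
  have hker : ∀ n, ∀ y ∈ Y n, ∀ z ∈ haarBlock T S (n + 1), y z = 0 := by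
    intro n y hy z hz
    have hle : haarBlock T S (n + 1) ≤ LinearMap.ker y.toLinearMap := by
      refine Submodule.span_le.2 ?_
      rintro _ ⟨j, hj, hj', rfl⟩
      rw [pow_succ] at hj hj'
      obtain ⟨k, rfl⟩ := Nat.exists_eq_add_of_le (show 2 ^ n ≤ j by omega)
      exact (hY n).2 y hy k (by omega) (by omega)
    exact hle hz
  refine isFDDWithConstantLE_of_norm_partialSum_le (fun n => ?_) fun v hv N M hNM => ?_
  · refine FiniteDimensional.span_of_finite ℝ
      (((Finset.finite_toSet (Finset.range (2 ^ n + 1))).image fun j => T (S.haar j)).subset ?_)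
    rintro x ⟨j, -, hj, rfl⟩
    exact ⟨j, by simpa using Nat.lt_succ_of_le hj, rfl⟩
  have hstep : ∀ N, ‖∑ n ∈ Finset.range (N + 1), v n‖
      ≤ τ N * ‖∑ n ∈ Finset.range (N + 2), v n‖ := by
    intro N
    obtain ⟨y, hy, hle⟩ := (hY N).1.2 (∑ n ∈ Finset.range (N + 1), v n)
      (sum_mem fun n hn => hblock n N (by simpa [Nat.lt_succ_iff] using hn) (hv n))
    refine hle.trans (mul_le_mul_of_nonneg_left ?_ (zero_le_one.trans (hτ N).le))
    have h : y (∑ n ∈ Finset.range (N + 2), v n) = y (∑ n ∈ Finset.range (N + 1), v n) := by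
      rw [Finset.sum_range_succ _ (N + 1), map_add, hker N y hy _ (hv (N + 1)), add_zero]
    rw [← h]
    refine (le_abs_self _).trans ((y.le_opNorm _).trans ?_)
    rw [(hY N).1.1 y hy, one_mul]
  have hmono' : Monotone fun N =>
      (∏ n ∈ Finset.range N, τ n) * ‖∑ n ∈ Finset.range (N + 1), v n‖ :=
    monotone_nat_of_le_succ fun N => by
      rw [Finset.prod_range_succ, mul_assoc]
      exact mul_le_mul_of_nonneg_left (hstep N) (zero_le_one.trans (hprod0 N))
  rcases N with _ | N
  · simpa using mul_nonneg hP0 (norm_nonneg _)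
  obtain ⟨M, rfl⟩ : ∃ m, M = m + 1 := ⟨M - 1, by omega⟩
  calc ‖∑ n ∈ Finset.range (N + 1), v n‖
      ≤ (∏ n ∈ Finset.range N, τ n) * ‖∑ n ∈ Finset.range (N + 1), v n‖ :=
        le_mul_of_one_le_left (norm_nonneg _) (hprod0 N)
    _ ≤ (∏ n ∈ Finset.range M, τ n) * ‖∑ n ∈ Finset.range (M + 1), v n‖ :=
        hmono' (by omega)
    _ ≤ P * ‖∑ n ∈ Finset.range (M + 1), v n‖ :=
        mul_le_mul_of_nonneg_right (hP1 M) (norm_nonneg _)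

end Decomposition

/-! ### Splittings for operators that are not completely continuous -/

theorem theorem1 {X : Type*} [NormedAddCommGroup X] [NormedSpace ℝ X] [CompleteSpace X]
    (T : L1 →L[ℝ] X) (hT : ¬ IsCompletelyContinuous T) (τ : ℕ → ℝ) (hτ : ∀ n, 1 < τ n) :
    (∃ (S : DyadicSplitting) (x : ℕ → StrongDual ℝ X) (Y : ℕ → Finset (StrongDual ℝ X)),
      (∀ n, ‖x n‖ = 1) ∧
      ∃ δ : ℝ, 0 < δ ∧ ∀ n : ℕ,
        (∀ k : ℕ, 1 ≤ k → k ≤ 2 ^ n → δ < x n (T (S.haar (2 ^ n + k)))) ∧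
        NormsWithin (Y n : Set (StrongDual ℝ X)) (initialSpan T S n) (τ n) ∧
        (∀ y ∈ Y n, ∀ k : ℕ, 1 ≤ k → k ≤ 2 ^ n → y (T (S.haar (2 ^ n + k))) = 0)) ∧
    (∀ (S : DyadicSplitting) (Y : ℕ → Finset (StrongDual ℝ X)),
      (∀ n : ℕ,
        NormsWithin (Y n : Set (StrongDual ℝ X)) (initialSpan T S n) (τ n) ∧
        (∀ y ∈ Y n, ∀ k : ℕ, 1 ≤ k → k ≤ 2 ^ n → y (T (S.haar (2 ^ n + k))) = 0)) →
      ∀ P : ℝ, Tendsto (fun N => ∏ n ∈ Finset.range N, τ n) atTop (𝓝 P) →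
        IsFDDWithConstantLE (haarBlock T S) P) := by
  exact ⟨exists_dyadicSplitting hT hτ,
    fun S Y hY _ hP => isFDDWithConstantLE_haarBlock hτ S Y hY hP⟩
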